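/- Let $T>0$, $d\ge 2$, and let $(\Omega,\mathcal F,\mathbb F=(\mathcal F_t)_{t\in[0,T]},P)$ be a filtered probability space satisfying the usual conditions. Let $\xi=(\xi^1,\dots,\xi^d)$ be an $\mathcal F_T$-measurable random vector, $f=(f^1,\dots,f^d):\Omega\times[0,T]\times\mathbb R^d\to\mathbb R^d$ a measurable function such that $f(\cdot,y)$ is progressively measurable for every $y\in\mathbb R^d$, $V=(V^1,\dots,V^d)$ a progressively measurable process of finite variation, and $U=(U^1,\dots,U^d)$ an adapted càdlàg process. For $j\neq k$ let $h_{j,k}(t,c)$, $t\in[0,T]$, $c\in\mathbb R$, be functions (deterministic, or depending also on $\omega\in\Omega$, in which case the conditions on $h$ and $H$ below are required for $P$-a.e. $\omega$) which are continuous in $(t,c)$ and satisfy $h_{j,k}(t,c)\le c$. Put $$H^j_t(y)=\max_{k\ne j}h_{j,k}(t,y^k),\qquad y\in\mathbb R^d,\ j=1,\dots,d,$$ and assume that $H_t(y)\le H_t(y')$ whenever $y\le y'$ (all inequalities between vectors are componentwise). A solution of $ORBSDE(\xi,f+dV,H,U)$ is a quadruple $(Y,M,K,A)$ of $\mathbb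 R^d$-valued adapted càdlàg processes such that a.s., for $j=1,\dots,d$: (i) $Y^j$ is of class D, $M^j$ is a local martingale with $M^j_0=0$, and $K^j,A^j$ are predictable increasing processes with $K^j_0=A^j_0=0$; (ii) $H^j_t(Y_t)\le Y^j_t\le U^j_t$ for all $t\in[0,T]$; (iii) $\int_0^T (Y^j_{r-}-H^j_{r-}(Y_{r-}))\,dK^j_r=\int_0^T(U^j_{r-}-Y^j_{r-})\,dA^j_r=0$, where $H_{r-}(Y_{r-})=\lim_{s\nearrow r}H_s(Y_s)$ and the integrals are over $(0,T]$; (iv) $\int_0^T|f^j(r,Y_r)|\,dr<\infty$ and, for all $t\in[0,T]$, $$Y^j_t=\xi^j+\int_t^Tf^j(r,Y_r)\,dr+\int_t^TdV^j_r+\int_t^TdK^j_r-\int_t^TdA^j_r-\int_t^TdM^j_r.$$ Assume moreover that: * $\mathbb F$ is quasi-left continuous, i.e. $\mathcal F_\tau=\mathcal F_{\tau-}$ for every predictable stopping time $\tau\le T$; * $V$ has no predictable jumps, i.e. $\Delta V_\tau=0$ a.s. for every predictable stopping time $\tau\le T$; * (A8) there are no $t\in[0,T]$, $n\ge1$, indices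 $j_1,\dots,j_n\in\{1,\dots,d\}$ with $j_i\ne j_{i+1}$ for $i=1,\dots,n$ and reals $y_1,\dots,y_n$ (where $j_{n+1}=j_1$, $y_{n+1}=y_1$) such that $y_i=h_{j_i,j_{i+1}}(t,y_{i+1})$ for $i=1,\dots,n$. Let $(Y,M,K,A)$ be a solution of $ORBSDE(\xi,f+dV,H,U)$ such that, for each $j$, a.s. $K^j$ and $A^j$ have no common jumps (as is the case, in particular, when the measures $dK^j$ and $dA^j$ are mutually singular). Then a.s. the paths of $K=(K^1,\dots,K^d)$ are continuous on $[0,T]$. -/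

import Mathlib

open MeasureTheory ProbabilityTheory Set Filter Topology

noncomputable section

namespace ORBSDE

/-- The time interval `[0, T]`. -/
abbrev Time (T : ℝ) : Type := Set.Icc (0 : ℝ) T

/-- Closed order intervals of `[0, T]` are compact (needed for Stieltjes measures on `[0, T]`). -/
instance instCompactIccSpaceTime (T : ℝ) : CompactIccSpace (Time T) where
  isCompact_Icc {_ _} := isClosed_Icc.isCompact

/-- Lebesgue measure `dr` on `[0, T]`. -/
def timeMeasure (T : ℝ) : Measure (Time T) := (volume : Measure ℝ).comap Subtype.val

/-- A càdlàg path: right-continuous, with a left limit in `ℝ` at every time. -/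
def IsCadlag {T : ℝ} (g : Time T → ℝ) : Prop :=
  ∀ t, ContinuousWithinAt g (Ici t) t ∧ ∃ l : ℝ, Tendsto g (𝓝[<] t) (𝓝 l)

/-- The jump `Δg_t = g_t - g_{t-}`, with the convention `g_{0-} = g_0`. -/
def jump {T : ℝ} (g : Time T → ℝ) (t : Time T) : ℝ := g t - Function.leftLim g t

open Classical in
/-- The Lebesgue-Stieltjes measure `dg` on `(0, T]` of an increasing path `g`; it charges `(s, t]`
with `g t - g s` if `g` is also right-continuous, and it does not charge `{0}`.
(Paths that are not increasing get the dummy value `0`.) -/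
def pathMeasure {T : ℝ} (g : Time T → ℝ) : Measure (Time T) :=
  if hg : Monotone g then hg.stieltjesFunction.measure else 0

section Filtered

variable {Ω : Type*} [mΩ : MeasurableSpace Ω] {T : ℝ} [Fact (0 ≤ T)]

/-- The usual conditions: the filtration is right-continuous and `𝓕 0` contains all `P`-null
sets. -/
structure UsualConditions (P : Measure Ω) (𝓕 : Filtration (Time T) mΩ) : Prop where
  rightContinuous : 𝓕.IsRightContinuous
  complete : ∀ s : Set Ω, P s = 0 → MeasurableSet[𝓕 ⊥] s

/-- `τ` is a stopping time with values in `[0, T]`. -/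
def IsStopping (𝓕 : Filtration (Time T) mΩ) (τ : Ω → Time T) : Prop :=
  IsStoppingTime 𝓕 (fun ω => (τ ω : WithTop (Time T)))

/-- `τ` is a predictable stopping time with values in `[0, T]`: it is announced by an increasing
sequence of stopping times which are `< τ` on `{τ > 0}` and converge to `τ`. -/
def IsPredictableTime (P : Measure Ω) (𝓕 : Filtration (Time T) mΩ) (τ : Ω → Time T) : Prop :=
  IsStopping 𝓕 τ ∧ ∃ σ : ℕ → Ω → Time T, (∀ n, IsStopping 𝓕 (σ n)) ∧
    ∀ᵐ ω ∂P, Monotone (fun n => σ n ω) ∧ (⊥ < τ ω → ∀ n, σ n ω < τ ω) ∧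
      Tendsto (fun n => σ n ω) atTop (𝓝 (τ ω))

/-- The σ-algebra `𝓕_{τ-}`, generated by `𝓕 0` and the sets `A ∩ {t < τ}` with `A ∈ 𝓕 t`. -/
@[reducible]
def sigmaAlgebraBefore (𝓕 : Filtration (Time T) mΩ) (τ : Ω → Time T) : MeasurableSpace Ω :=
  MeasurableSpace.generateFrom
    ({A | MeasurableSet[𝓕 ⊥] A} ∪
      {B | ∃ (t : Time T) (A : Set Ω), MeasurableSet[𝓕 t] A ∧ B = A ∩ {ω | t < τ ω}})

/-- Quasi-left continuity of the filtration: `𝓕_τ = 𝓕_{τ-}` for every predictable time `τ`. -/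
def QuasiLeftContinuous (P : Measure Ω) (𝓕 : Filtration (Time T) mΩ) : Prop :=
  ∀ (τ : Ω → Time T) (hτ : IsStopping 𝓕 τ), IsPredictableTime P 𝓕 τ →
    IsStoppingTime.measurableSpace hτ = sigmaAlgebraBefore 𝓕 τ

/-- The process `X` has no predictable jumps: `ΔX_τ = 0` a.s. for every predictable time `τ`. -/
def NoPredictableJumps (P : Measure Ω) (𝓕 : Filtration (Time T) mΩ)
    (X : Time T → Ω → ℝ) : Prop :=
  ∀ τ : Ω → Time T, IsPredictableTime P 𝓕 τ → ∀ᵐ ω ∂P, jump (fun t => X t ω) (τ ω) = 0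

/-- Doob's class D: the values `X_τ`, over all stopping times `τ` with values in `[0, T]`, are
uniformly integrable. -/
def ClassD (P : Measure Ω) (𝓕 : Filtration (Time T) mΩ) (X : Time T → Ω → ℝ) : Prop :=
  UniformIntegrable (fun (τ : {τ : Ω → Time T // IsStopping 𝓕 τ}) ω => X (τ.1 ω) ω) 1 P

/-- Adapted processes with (almost surely) càdlàg paths. -/
structure IsCadlagAdapted (P : Measure Ω) (𝓕 : Filtration (Time T) mΩ)
    (X : Time T → Ω → ℝ) : Prop where
  adapted : StronglyAdapted 𝓕 X
  cadlag : ∀ᵐ ω ∂P, IsCadlag (fun t => X t ω)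

/-- Progressively measurable processes of finite variation on `[0, T]`. -/
structure IsFiniteVariation (P : Measure Ω) (𝓕 : Filtration (Time T) mΩ)
    (X : Time T → Ω → ℝ) : Prop where
  progressive : IsStronglyProgressive 𝓕 X
  boundedVariation : ∀ᵐ ω ∂P, BoundedVariationOn (fun t => X t ω) univ

/-- Predictable increasing càdlàg processes `X` with `X_0 = 0`. -/
structure IsPredictableIncreasing (P : Measure Ω) (𝓕 : Filtration (Time T) mΩ)
    (X : Time T → Ω → ℝ) : Prop where
  predictable : IsStronglyPredictable 𝓕 X
  cadlag : ∀ᵐ ω ∂P, IsCadlag (fun t => X t ω)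
  monotone : ∀ᵐ ω ∂P, Monotone (fun t => X t ω)
  zero : ∀ᵐ ω ∂P, X ⊥ ω = 0

/-- Càdlàg local martingales `X` with `X_0 = 0`. (In `Locally`, the localizing stopping times
take values in `[0, T] ∪ {⊤}` and, `⊤` being isolated there, almost every path is eventually not
stopped at all: this is the usual notion on a compact time interval.) -/
structure IsLocalMartingaleZero (P : Measure Ω) (𝓕 : Filtration (Time T) mΩ)
    (X : Time T → Ω → ℝ) : Prop where
  cadlagAdapted : IsCadlagAdapted P 𝓕 X
  locallyMartingale : Locally (fun Z => Martingale Z 𝓕 P) 𝓕 X P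
  zero : ∀ᵐ ω ∂P, X ⊥ ω = 0

/-- `(Y, M, K, A)` is a solution of the system of reflected BSDEs with terminal condition `ξ`,
generator `f + dV`, oblique reflection from below driven by `H` and upper barrier `U`.
First arguments `j : Fin d` denote components, `y : Fin d → ℝ` is the space variable. -/
structure IsSolution {d : ℕ} (P : Measure Ω) (𝓕 : Filtration (Time T) mΩ)
    (ξ : Fin d → Ω → ℝ) (f : Fin d → Time T → Ω → (Fin d → ℝ) → ℝ)
    (V : Fin d → Time T → Ω → ℝ) (H : Fin d → Time T → Ω → (Fin d → ℝ) → ℝ)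
    (U Y M K A : Fin d → Time T → Ω → ℝ) : Prop where
  Y_cadlagAdapted : ∀ j, IsCadlagAdapted P 𝓕 (Y j)
  Y_classD : ∀ j, ClassD P 𝓕 (Y j)
  M_localMartingale : ∀ j, IsLocalMartingaleZero P 𝓕 (M j)
  K_predictableIncreasing : ∀ j, IsPredictableIncreasing P 𝓕 (K j)
  A_predictableIncreasing : ∀ j, IsPredictableIncreasing P 𝓕 (A j)
  /-- `H_t(Y_t) ≤ Y_t ≤ U_t`. -/
  barriers : ∀ᵐ ω ∂P, ∀ j t, H j t ω (fun i => Y i t ω) ≤ Y j t ω ∧ Y j t ω ≤ U j t ω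
  /-- `∫_{(0,T]} (Y_{r-} - H_{r-}(Y_{r-})) dK_r = 0`, where `H_{r-}(Y_{r-})` is the left limit at
  `r` of `s ↦ H_s(Y_s)`. -/
  minimality_K : ∀ᵐ ω ∂P, ∀ j,
    Integrable (fun r => Function.leftLim (fun s => Y j s ω) r
      - Function.leftLim (fun s => H j s ω (fun i => Y i s ω)) r)
        (pathMeasure (fun t => K j t ω)) ∧
    ∫ r, (Function.leftLim (fun s => Y j s ω) r
      - Function.leftLim (fun s => H j s ω (fun i => Y i s ω)) r)
        ∂(pathMeasure (fun t => K j t ω)) = 0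
  /-- `∫_{(0,T]} (U_{r-} - Y_{r-}) dA_r = 0`. -/
  minimality_A : ∀ᵐ ω ∂P, ∀ j,
    Integrable (fun r => Function.leftLim (fun s => U j s ω) r
      - Function.leftLim (fun s => Y j s ω) r) (pathMeasure (fun t => A j t ω)) ∧
    ∫ r, (Function.leftLim (fun s => U j s ω) r
      - Function.leftLim (fun s => Y j s ω) r) ∂(pathMeasure (fun t => A j t ω)) = 0
  /-- `∫_0^T |f(r, Y_r)| dr < ∞`. -/
  generator_integrable : ∀ᵐ ω ∂P, ∀ j,
    Integrable (fun r => f j r ω (fun i => Y i r ω)) (timeMeasure T)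
  /-- The backward equation on `[t, T]` (`⊤` is the final time `T`). -/
  equation : ∀ᵐ ω ∂P, ∀ j t,
    Y j t ω = ξ j ω + (∫ r in Ioi t, f j r ω (fun i => Y i r ω) ∂(timeMeasure T))
      + (V j ⊤ ω - V j t ω) + (K j ⊤ ω - K j t ω) - (A j ⊤ ω - A j t ω)
      - (M j ⊤ ω - M j t ω)

end Filtered

/-- The reflection function `H^j_t(y) = max_{k ≠ j} h_{j,k}(t, y^k)` (a maximum over a finite set,
nonempty as soon as there are at least two modes). -/
def obliqueMax {d : ℕ} {T : ℝ} {Ω : Type*} (h : Fin d → Fin d → Time T → Ω → ℝ → ℝ)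
    (j : Fin d) (t : Time T) (ω : Ω) (y : Fin d → ℝ) : ℝ :=
  ⨆ k : {k : Fin d // k ≠ j}, h j k t ω (y k)

/-- There is no time `t` and no cycle of modes `j_0 → j_1 → ⋯ → j_n = j_0`, with consecutive modes
distinct, along which `y_i = h_{j_i, j_{i+1}}(t, y_{i+1})` for reals `y_0, …, y_n = y_0`. -/
def NoCycle {d : ℕ} {T : ℝ} (h : Fin d → Fin d → Time T → ℝ → ℝ) : Prop :=
  ¬ ∃ (t : Time T) (n : ℕ) (j : ℕ → Fin d) (y : ℕ → ℝ),
    0 < n ∧ j n = j 0 ∧ y n = y 0 ∧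
      ∀ i < n, j i ≠ j (i + 1) ∧ y i = h (j i) (j (i + 1)) t (y (i + 1))

end ORBSDE

end

/-!
The processes `K^j` cannot jump because a jump of one of them would start a cycle of modes.

Let `t` be a time at which no `M^i` and no `V^i` jumps. Then the backward equation gives
`ΔY^i_t = ΔA^i_t - ΔK^i_t` for all `i`. If `ΔK^j_t > 0`, then `ΔA^j_t = 0`, so `Y^j` jumps down,
while minimality of `K^j` gives `Y^j_{t-} = H^j_t(Y_{t-}) = h_{j,k}(t, Y^k_{t-})` for some `k ≠ j`.
As `H^j_t(Y_t) ≤ Y^j_t < h_{j,k}(t, Y^k_{t-})` and `H^j_t` is nondecreasing, `Y^k` jumps down too,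
which is only possible if `ΔK^k_t > 0`. Iterating, one runs through a cycle of modes excluded by
`NoCycle`. This is `jump_eq_zero_of_equation`.

It remains to see that almost surely all jump times of `K^j` are of this kind.

* They are exhausted by countably many announceable times
  (`exists_isPredictableTime_exhausting_jumps`). A jump of `K^j` occurs when `K^j` first reaches
  some rational level, and the graph of this time is a predictable set, so a section theorem
  restricted to graphs is enough (`exists_isPredictableTime_of_subset_graph`). Along a random time,
  a predictable set is approximated from inside by decreasing intersections of random closed sets
  that are known a little in advance (`isInnerApproximable_of_predictable`), and the debut of such
  an intersection is announced by the debuts of these sets, moved slightly to the left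
  (`exists_isPredictableTime_isLeast`).
* At a predictable time, `V` does not jump by assumption, and a local martingale does not jump if
  the filtration is quasi-left continuous (`jump_localMartingale_eq_zero`): by optional stopping and
  Lévy's upward theorem, the left limit and the value at `τ` of a martingale `N` are the conditional
  expectations of `N_T` given `𝓕_{τ-}` and `𝓕_τ`, which agree.
-/

namespace ORBSDE

/-! ### Cycles of modes at a jump -/

/-- Along a sequence of modes in a finite set, two modes agree, so the part of the sequence between
them is a cycle. -/
theorem NoCycle.not_forall_exists {d : ℕ} {T : ℝ} {h : Fin d → Fin d → Time T → ℝ → ℝ}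
    (hh : NoCycle h) (t : Time T) (y : Fin d → ℝ) (S : Set (Fin d)) (hS : S.Nonempty) :
    ¬ ∀ j ∈ S, ∃ k ∈ S, k ≠ j ∧ y j = h j k t (y k) := by
  intro hstep
  obtain ⟨j₀, hj₀⟩ := hS
  choose! next hnext_mem hnext_ne hnext_eq using hstep
  set J : ℕ → Fin d := fun n => next^[n] j₀ with hJ
  have hJsucc : ∀ n, J (n + 1) = next (J n) := fun n => Function.iterate_succ_apply' next n j₀
  have hJS : ∀ n, J n ∈ S := by
    intro n
    induction n with
    | zero => exact hj₀
    | succ n ih => rw [hJsucc]; exact hnext_mem _ ih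
  obtain ⟨m, n, hmn, hEq⟩ : ∃ m n, m < n ∧ J m = J n := by
    obtain ⟨m, n, hne, hEq⟩ := Finite.exists_ne_map_eq_of_infinite J
    rcases lt_or_gt_of_ne hne with hlt | hlt
    · exact ⟨m, n, hlt, hEq⟩
    · exact ⟨n, m, hlt, hEq.symm⟩
  refine hh ⟨t, n - m, fun i => J (m + i), fun i => y (J (m + i)), by omega, ?_, ?_, ?_⟩
  · simp only [add_zero, Nat.add_sub_cancel' hmn.le, hEq]
  · simp only [add_zero, Nat.add_sub_cancel' hmn.le, hEq]
  · intro i _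
    have hs : J (m + (i + 1)) = next (J (m + i)) := hJsucc (m + i)
    refine ⟨?_, ?_⟩
    · simp only [hs]
      exact (hnext_ne _ (hJS _)).symm
    · simp only [hs]
      exact hnext_eq _ (hJS _)

/-- If the maximum `H^j(y)` decreases from `y` to `y'` below one of the terms `h_{j,k}(y^k)`, then
the coordinate `y^k` itself must have decreased. This only uses that the maximum, and not each
`h_{j,k}`, is nondecreasing. -/
theorem lt_of_obliqueMax_lt {d : ℕ} {T : ℝ} {Ω : Type*}
    {h : Fin d → Fin d → Time T → Ω → ℝ → ℝ} {j k : Fin d} (hk : k ≠ j) {t : Time T} {ω : Ω}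
    (H_mono : ∀ y y' : Fin d → ℝ, y ≤ y' → obliqueMax h j t ω y ≤ obliqueMax h j t ω y')
    {y y' : Fin d → ℝ} (hlt : obliqueMax h j t ω y' < h j k t ω (y k)) : y' k < y k := by
  by_contra hle
  rw [not_lt] at hle
  have hz : Function.update y' k (y k) ≤ y' := by
    rw [update_le_iff]
    exact ⟨hle, fun _ _ => le_rfl⟩
  have h1 := H_mono _ _ hz
  have h2 : h j k t ω (y k) ≤ obliqueMax h j t ω (Function.update y' k (y k)) := by
    have := le_ciSup (f := fun i : {i : Fin d // i ≠ j} =>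
      h j i t ω (Function.update y' k (y k) i)) (Set.finite_range _).bddAbove ⟨k, hk⟩
    simpa [obliqueMax] using this
  linarith

/-- A downward jump of `Y^j` caused by `K^j` forces a downward jump of some `Y^k`, `k ≠ j`, again
caused by `K^k`, so that the jumps at one time propagate along a cycle. Here `y` stands for
`Y_{t-}`, `y'` for `Y_t`, and `κ`, `α` for the jumps of `K` and `A`. -/
theorem eq_zero_of_jump_relations {d : ℕ} (hd : 2 ≤ d) {T : ℝ} {Ω : Type*}
    {h : Fin d → Fin d → Time T → Ω → ℝ → ℝ} {t : Time T} {ω : Ω}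
    (H_mono : ∀ j, ∀ y y' : Fin d → ℝ, y ≤ y' → obliqueMax h j t ω y ≤ obliqueMax h j t ω y')
    (hh : NoCycle (fun j k t c => h j k t ω c)) {y y' κ α : Fin d → ℝ}
    (hκ : ∀ j, 0 ≤ κ j) (hα : ∀ j, 0 ≤ α j) (hy : ∀ j, y' j - y j = α j - κ j)
    (hκα : ∀ j, κ j = 0 ∨ α j = 0) (hmin : ∀ j, 0 < κ j → y j = obliqueMax h j t ω y)
    (hbar : ∀ j, obliqueMax h j t ω y' ≤ y' j) (j : Fin d) : κ j = 0 := by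
  by_contra hj
  refine hh.not_forall_exists t y {j | 0 < κ j} ⟨j, lt_of_le_of_ne (hκ j) (Ne.symm hj)⟩ ?_
  intro i hi
  have hi' : 0 < κ i := hi
  have hαi : α i = 0 := (hκα i).resolve_left hi'.ne'
  have : Nonempty {k : Fin d // k ≠ i} := by
    have : Nontrivial (Fin d) := Fin.nontrivial_iff_two_le.2 hd
    obtain ⟨k, hk⟩ := exists_ne i
    exact ⟨⟨k, hk⟩⟩
  obtain ⟨⟨k, hk⟩, hkmax⟩ := exists_eq_ciSup_of_finite
    (f := fun k : {k : Fin d // k ≠ i} => h i k t ω (y k))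
  have hik : y i = h i k t ω (y k) := (hmin i hi').trans hkmax.symm
  refine ⟨k, ?_, hk, hik⟩
  have hlt : y' k < y k := by
    refine lt_of_obliqueMax_lt hk (H_mono i) ?_
    rw [← hik]
    have := hbar i
    have := hy i
    linarith
  have := hy k
  have := hα k
  change 0 < κ k
  linarith

/-! ### Jumps of the paths of a solution -/

theorem timeMeasure_singleton {T : ℝ} (t : Time T) : timeMeasure T {t} = 0 := by
  rw [timeMeasure, (MeasurableEmbedding.subtype_coe measurableSet_Icc).comap_apply]
  simp

theorem continuous_setIntegral_Ioi_timeMeasure {T : ℝ} {g : Time T → ℝ}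
    (hg : Integrable g (timeMeasure T)) :
    Continuous (fun t : Time T => ∫ r in Ioi t, g r ∂(timeMeasure T)) := by
  rw [continuous_iff_continuousAt]
  intro t
  simp_rw [← integral_indicator measurableSet_Ioi]
  refine tendsto_integral_filter_of_dominated_convergence (fun r => ‖g r‖) ?_ ?_ hg.norm ?_
  · exact Eventually.of_forall fun s => hg.aestronglyMeasurable.indicator measurableSet_Ioi
  · exact Eventually.of_forall fun s =>
      Eventually.of_forall fun r => norm_indicator_le_norm_self _ _
  · have hne : ∀ᵐ r ∂(timeMeasure T), r ≠ t := by
      rw [ae_iff]; simpa using timeMeasure_singleton t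
    filter_upwards [hne] with r hr
    refine tendsto_const_nhds.congr' ?_
    rcases lt_or_gt_of_ne hr with hlt | hlt
    · filter_upwards [lt_mem_nhds hlt] with s hs
      rw [indicator_of_notMem (by simp [hlt.le]), indicator_of_notMem (by simpa using hs.le)]
    · filter_upwards [gt_mem_nhds hlt] with s hs
      rw [indicator_of_mem (by simpa using hlt), indicator_of_mem (by simpa using hs)]

theorem IsCadlag.tendsto_leftLim {T : ℝ} {g : Time T → ℝ} (hg : IsCadlag g) (t : Time T) :
    Tendsto g (𝓝[<] t) (𝓝 (Function.leftLim g t)) :=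
  tendsto_leftLim_of_tendsto (hg t).2

theorem isCadlag_const {T : ℝ} (c : ℝ) : IsCadlag (fun _ : Time T => c) := fun _ =>
  ⟨continuousWithinAt_const, c, tendsto_const_nhds⟩

theorem IsCadlag.comp_min {T : ℝ} {g : Time T → ℝ} (hg : IsCadlag g) (r : Time T) :
    IsCadlag (fun t => g (min t r)) := by
  intro t
  refine ⟨?_, ?_⟩
  · refine ContinuousWithinAt.comp (t := Ici (min t r)) (hg (min t r)).1
      (continuous_id.min continuous_const).continuousWithinAt ?_
    exact fun s hs => mem_Ici.2 (min_le_min_right r (mem_Ici.1 hs))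
  · rcases le_or_gt t r with h | h
    · obtain ⟨l, hl⟩ := (hg t).2
      refine ⟨l, hl.congr' ?_⟩
      filter_upwards [self_mem_nhdsWithin] with s hs
      rw [min_eq_left ((le_of_lt hs).trans h)]
    · refine ⟨g r, tendsto_const_nhds.congr' ?_⟩
      filter_upwards [mem_nhdsWithin_of_mem_nhds (lt_mem_nhds h)] with s hs
      rw [min_eq_right (le_of_lt hs)]

theorem nhdsLT_neBot {T : ℝ} [Fact (0 ≤ T)] {t : Time T} (ht : ⊥ < t) : (𝓝[<] t).NeBot := by
  exact nhdsLT_neBot_of_exists_lt ⟨⊥, ht⟩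

theorem jump_nonneg {T : ℝ} {g : Time T → ℝ} (hg : Monotone g) (t : Time T) : 0 ≤ jump g t :=
  sub_nonneg.2 (hg.leftLim_le le_rfl)

theorem jump_bot {T : ℝ} [Fact (0 ≤ T)] (g : Time T → ℝ) : jump g ⊥ = 0 := by
  rw [jump, leftLim_eq_of_isBot isBot_bot, sub_self]

theorem jump_eq_of_tendsto {T : ℝ} [Fact (0 ≤ T)] {g : Time T → ℝ} {t : Time T} (ht : ⊥ < t) {l : ℝ}
    (hl : Tendsto g (𝓝[<] t) (𝓝 l)) : jump g t = g t - l := by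
  have := nhdsLT_neBot ht
  rw [jump, leftLim_eq_of_tendsto hl]

theorem IsCadlag.continuous_of_jump_eq_zero {T : ℝ} {g : Time T → ℝ} (hg : IsCadlag g)
    (h0 : ∀ t, jump g t = 0) : Continuous g := by
  rw [continuous_iff_continuousAt]
  intro t
  rw [continuousAt_iff_continuous_left_right]
  refine ⟨?_, (hg t).1⟩
  rw [← continuousWithinAt_Iio_iff_Iic]
  have := hg.tendsto_leftLim t
  rwa [← sub_eq_zero.1 (h0 t)] at this

theorem rightLim_eq_of_isCadlag {T : ℝ} {g : Time T → ℝ} (hg : IsCadlag g) (t : Time T) :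
    Function.rightLim g t = g t := by
  exact (hg t).1.rightLim_eq

/-- The Lebesgue-Stieltjes measure of an increasing càdlàg path charges its jump times, so a
nonnegative integrand with zero integral vanishes there. -/
theorem eq_zero_of_integral_pathMeasure_eq_zero {T : ℝ} {g φ : Time T → ℝ}
    (hg : IsCadlag g) (hmono : Monotone g) (hφ : ∀ t, 0 ≤ φ t)
    (hint : Integrable φ (pathMeasure g)) (h0 : ∫ r, φ r ∂(pathMeasure g) = 0)
    {t : Time T} (ht : 0 < jump g t) : φ t = 0 := by
  rw [integral_eq_zero_iff_of_nonneg hφ hint] at h0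
  by_contra hne
  have hsub : ({t} : Set (Time T)) ⊆ {r | ¬ φ r = (0 : Time T → ℝ) r} := by
    rintro r rfl
    exact hne
  have hzero : pathMeasure g {t} = 0 := measure_mono_null hsub (ae_iff.1 h0)
  rw [pathMeasure, dif_pos hmono, StieltjesFunction.measure_singleton] at hzero
  have hfun : (hmono.stieltjesFunction : Time T → ℝ) = g := by
    funext s
    rw [Monotone.stieltjesFunction_eq, rightLim_eq_of_isCadlag hg]
  rw [hfun, ENNReal.ofReal_eq_zero] at hzero
  exact absurd ht (not_lt.2 hzero)

theorem tendsto_obliqueMax {d : ℕ} {T : ℝ} {Ω : Type*}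
    {h : Fin d → Fin d → Time T → Ω → ℝ → ℝ} {ω : Ω} {j : Fin d}
    (h_cont : ∀ k, j ≠ k → Continuous (fun p : Time T × ℝ => h j k p.1 ω p.2))
    {t : Time T} {F : Filter (Time T)} (hF : F ≤ 𝓝 t) {Y : Fin d → Time T → ℝ} {y : Fin d → ℝ}
    (hY : ∀ k, Tendsto (Y k) F (𝓝 (y k))) :
    Tendsto (fun s => obliqueMax h j s ω (fun i => Y i s)) F (𝓝 (obliqueMax h j t ω y)) := by
  classical
  unfold obliqueMax
  have hterm : ∀ k : {k : Fin d // k ≠ j},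
      Tendsto (fun s => h j k s ω (Y k s)) F (𝓝 (h j k t ω (y k))) := fun k =>
    ((h_cont k k.2.symm).tendsto (t, y k)).comp
      ((tendsto_id.mono_right hF).prodMk_nhds (hY k))
  cases isEmpty_or_nonempty {k : Fin d // k ≠ j} with
  | inl _ => simpa only [Real.iSup_of_isEmpty] using tendsto_const_nhds
  | inr _ =>
    simp_rw [← Finset.sup'_univ_eq_ciSup]
    exact Tendsto.finset_sup'_nhds_apply _ fun k _ => hterm k

/-- At a time where neither the local martingale parts nor the finite variation parts jump, the
increasing processes `K^j` of a solution do not jump either. -/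
theorem jump_eq_zero_of_equation {d : ℕ} (hd : 2 ≤ d) {T : ℝ} [Fact (0 ≤ T)] {Ω : Type*}
    {h : Fin d → Fin d → Time T → Ω → ℝ → ℝ} {ω : Ω}
    (h_cont : ∀ j k, j ≠ k → Continuous (fun p : Time T × ℝ => h j k p.1 ω p.2))
    (H_mono : ∀ j t (y y' : Fin d → ℝ), y ≤ y' → obliqueMax h j t ω y ≤ obliqueMax h j t ω y')
    (h_noCycle : NoCycle (fun j k t c => h j k t ω c))
    {x : Fin d → ℝ} {g V Y M K A : Fin d → Time T → ℝ}
    (hY : ∀ j, IsCadlag (Y j)) (hM : ∀ j, IsCadlag (M j)) (hK : ∀ j, IsCadlag (K j))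
    (hA : ∀ j, IsCadlag (A j)) (hKmono : ∀ j, Monotone (K j)) (hAmono : ∀ j, Monotone (A j))
    (hbar : ∀ j t, obliqueMax h j t ω (fun i => Y i t) ≤ Y j t)
    (hmin : ∀ j, Integrable (fun r => Function.leftLim (Y j) r
      - Function.leftLim (fun s => obliqueMax h j s ω (fun i => Y i s)) r) (pathMeasure (K j)) ∧
      ∫ r, (Function.leftLim (Y j) r
      - Function.leftLim (fun s => obliqueMax h j s ω (fun i => Y i s)) r) ∂(pathMeasure (K j)) = 0)
    (hg : ∀ j, Integrable (g j) (timeMeasure T))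
    (heq : ∀ j t, Y j t = x j + (∫ r in Ioi t, g j r ∂(timeMeasure T)) + (V j ⊤ - V j t)
      + (K j ⊤ - K j t) - (A j ⊤ - A j t) - (M j ⊤ - M j t))
    (hKA : ∀ j t, jump (K j) t = 0 ∨ jump (A j) t = 0)
    {t : Time T} (hMt : ∀ j, jump (M j) t = 0) (hVt : ∀ j, jump (V j) t = 0) (j : Fin d) :
    jump (K j) t = 0 := by
  rcases eq_bot_or_bot_lt t with rfl | ht
  · exact jump_bot _
  have hne := nhdsLT_neBot ht
  -- the left limit of `s ↦ H_s(Y_s)`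
  have hHlim : ∀ j s, Tendsto (fun s => obliqueMax h j s ω (fun i => Y i s)) (𝓝[<] s)
      (𝓝 (obliqueMax h j s ω (fun i => Function.leftLim (Y i) s))) := fun j s =>
    tendsto_obliqueMax (h_cont j) nhdsWithin_le_nhds fun k => (hY k).tendsto_leftLim s
  have hφ : ∀ j s, 0 ≤ Function.leftLim (Y j) s
      - Function.leftLim (fun s => obliqueMax h j s ω (fun i => Y i s)) s := by
    intro j s
    rcases eq_bot_or_bot_lt s with rfl | hs
    · rw [leftLim_eq_of_isBot isBot_bot, leftLim_eq_of_isBot isBot_bot]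
      exact sub_nonneg.2 (hbar j ⊥)
    · have := nhdsLT_neBot hs
      rw [leftLim_eq_of_tendsto (hHlim j s)]
      exact sub_nonneg.2 (le_of_tendsto_of_tendsto' (hHlim j s) ((hY j).tendsto_leftLim s)
        (hbar j))
  -- the backward equation turned into a relation between jumps
  have hjump : ∀ j, jump (Y j) t = jump (A j) t - jump (K j) t := by
    intro j
    have hI := (continuous_setIntegral_Ioi_timeMeasure (hg j)).tendsto t
    have hI' := hI.mono_left (nhdsWithin_le_nhds (s := Iio t))
    -- the paths of `V` are not assumed càdlàg: the equation provides their left limits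
    have hVlim : Tendsto (V j) (𝓝[<] t) (𝓝 (x j + (∫ r in Ioi t, g j r ∂(timeMeasure T)) + V j ⊤
        + (K j ⊤ - Function.leftLim (K j) t) - (A j ⊤ - Function.leftLim (A j) t)
        - (M j ⊤ - Function.leftLim (M j) t) - Function.leftLim (Y j) t)) := by
      have := ((((((hI'.const_add (x j)).add_const (V j ⊤)).add
        (((hK j).tendsto_leftLim t).const_sub (K j ⊤))).sub
        (((hA j).tendsto_leftLim t).const_sub (A j ⊤))).sub
        (((hM j).tendsto_leftLim t).const_sub (M j ⊤))).sub ((hY j).tendsto_leftLim t))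
      refine this.congr fun s => ?_
      have := heq j s
      linarith
    have h1 := jump_eq_of_tendsto ht hVlim
    rw [hVt j] at h1
    have h2 := hMt j
    have h3 := heq j t
    simp only [jump] at h1 h2 ⊢
    linarith
  refine eq_zero_of_jump_relations hd (t := t) (ω := ω) (h := h) (fun j => H_mono j t) h_noCycle
    (y := fun i => Function.leftLim (Y i) t) (y' := fun i => Y i t)
    (κ := fun i => jump (K i) t) (α := fun i => jump (A i) t)
    (fun i => jump_nonneg (hKmono i) t) (fun i => jump_nonneg (hAmono i) t) hjump
    (fun i => hKA i t) (fun i hi => ?_) (fun i => hbar i t) j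
  have h0 := eq_zero_of_integral_pathMeasure_eq_zero (hK i) (hKmono i) (hφ i) (hmin i).1
    (hmin i).2 hi
  rw [leftLim_eq_of_tendsto (hHlim i t)] at h0
  exact sub_eq_zero.1 h0

/-! ### Stopping times and null sets -/

section Stopping

variable {Ω : Type*} [mΩ : MeasurableSpace Ω] {T : ℝ} {𝓕 : Filtration (Time T) mΩ}

theorem isStopping_iff {τ : Ω → Time T} :
    IsStopping 𝓕 τ ↔ ∀ t, MeasurableSet[𝓕 t] {ω | τ ω ≤ t} := by
  simp only [IsStopping, IsStoppingTime, WithTop.coe_le_coe]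

theorem IsStopping.min {τ τ' : Ω → Time T} (hτ : IsStopping 𝓕 τ) (hτ' : IsStopping 𝓕 τ') :
    IsStopping 𝓕 (fun ω => min (τ ω) (τ' ω)) := by
  simpa only [IsStopping, WithTop.coe_min] using IsStoppingTime.min hτ hτ'

theorem IsStopping.max {τ τ' : Ω → Time T} (hτ : IsStopping 𝓕 τ) (hτ' : IsStopping 𝓕 τ') :
    IsStopping 𝓕 (fun ω => max (τ ω) (τ' ω)) := by
  simpa only [IsStopping, WithTop.coe_max] using IsStoppingTime.max hτ hτ'

theorem IsStopping.partialSups {σ : ℕ → Ω → Time T} (hσ : ∀ n, IsStopping 𝓕 (σ n)) (n : ℕ) :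
    IsStopping 𝓕 (partialSups σ n) := by
  induction n with
  | zero => simpa using hσ 0
  | succ n ih =>
    rw [partialSups_add_one]
    exact ih.max (hσ (n + 1))

theorem IsStopping.measurableSet_lt {τ : Ω → Time T} (hτ : IsStopping 𝓕 τ) (t : Time T) :
    MeasurableSet[𝓕 t] {ω | τ ω < t} := by
  simpa only [WithTop.coe_lt_coe] using IsStoppingTime.measurableSet_lt hτ t

/-- Under the usual conditions every `𝓕 t` contains all null sets. -/
theorem UsualConditions.measurableSet_of_null [Fact (0 ≤ T)] {P : Measure Ω}
    (h : UsualConditions P 𝓕) (t : Time T) {s : Set Ω} (hs : P s = 0) : MeasurableSet[𝓕 t] s :=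
  𝓕.mono bot_le _ (h.complete s hs)

end Stopping

/-! ### Discretization of time from the right -/

section RoundUp

variable {T : ℝ} [hT : Fact (0 ≤ T)]

/-- The time `s` rounded up to the grid of multiples of `1 / (n + 1)`, and capped at `T`. Grid
points are moved up too. -/
noncomputable def roundUp (n : ℕ) (s : Time T) : Time T :=
  projIcc 0 T hT.out ((⌊(s : ℝ) * (n + 1)⌋₊ + 1) / (n + 1))

theorem coe_roundUp (n : ℕ) (s : Time T) :
    (roundUp n s : ℝ) = min T ((⌊(s : ℝ) * (n + 1)⌋₊ + 1) / (n + 1)) := by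
  rw [roundUp, coe_projIcc, max_eq_right]
  exact le_min hT.out (by positivity)

theorem le_roundUp (n : ℕ) (s : Time T) : s ≤ roundUp n s := by
  rw [← Subtype.coe_le_coe, coe_roundUp]
  refine le_min s.2.2 ?_
  rw [le_div_iff₀ (by positivity)]
  exact (Nat.lt_floor_add_one _).le

theorem roundUp_le_add (n : ℕ) (s : Time T) : (roundUp n s : ℝ) ≤ s + 1 / (n + 1) := by
  rw [coe_roundUp]
  refine (min_le_right _ _).trans ?_
  rw [add_div]
  gcongr
  rw [div_le_iff₀ (by positivity)]
  exact Nat.floor_le (mul_nonneg s.2.1 (by positivity))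

theorem tendsto_roundUp (s : Time T) : Tendsto (fun n => roundUp n s) atTop (𝓝[≥] s) := by
  rw [tendsto_nhdsWithin_iff]
  refine ⟨?_, Eventually.of_forall fun n => le_roundUp n s⟩
  rw [tendsto_subtype_rng]
  refine tendsto_of_tendsto_of_tendsto_of_le_of_le tendsto_const_nhds ?_
    (fun n => le_roundUp n s) (fun n => roundUp_le_add n s)
  simpa using tendsto_one_div_add_atTop_nhds_zero_nat.const_add (s : ℝ)

theorem measurable_roundUp (n : ℕ) : Measurable (roundUp (T := T) n) := by
  unfold roundUp
  refine continuous_projIcc.measurable.comp ?_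
  have : Measurable fun s : Time T => ⌊(s : ℝ) * (n + 1)⌋₊ :=
    Nat.measurable_floor.comp (measurable_subtype_coe.mul_const _)
  exact ((measurable_from_top (f := fun k : ℕ => (k : ℝ))).comp this |>.add_const 1).div_const _

theorem countable_range_roundUp (n : ℕ) : (range (roundUp (T := T) n)).Countable := by
  refine (countable_range fun k : ℕ => projIcc 0 T hT.out ((k + 1 : ℝ) / (n + 1))).mono ?_
  rintro _ ⟨s, rfl⟩
  exact ⟨⌊(s : ℝ) * (n + 1)⌋₊, rfl⟩

variable {Ω : Type*} [mΩ : MeasurableSpace Ω] {𝓕 : Filtration (Time T) mΩ}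

theorem IsStopping.roundUp_comp {τ : Ω → Time T} (hτ : IsStopping 𝓕 τ) (n : ℕ) :
    IsStopping 𝓕 (fun ω => roundUp n (τ ω)) := by
  rw [isStopping_iff]
  intro t
  have hn : (0 : ℝ) < n + 1 := by positivity
  by_cases ht : (t : ℝ) = T
  · convert MeasurableSet.univ
    ext ω
    simp only [mem_ofPred_eq, mem_univ, iff_true, ← Subtype.coe_le_coe, ht]
    exact (roundUp n (τ ω)).2.2
  -- the event is `{τ < c}` for the largest grid point `c ≤ t`
  have hc0 : (0 : ℝ) ≤ (⌊(t : ℝ) * (n + 1)⌋₊ : ℝ) / (n + 1) := by positivity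
  have hct : (⌊(t : ℝ) * (n + 1)⌋₊ : ℝ) / (n + 1) ≤ t := by
    rw [div_le_iff₀ hn]
    exact Nat.floor_le (mul_nonneg t.2.1 hn.le)
  set c : Time T := ⟨(⌊(t : ℝ) * (n + 1)⌋₊ : ℝ) / (n + 1), hc0, hct.trans t.2.2⟩ with hc
  have hset : {ω | roundUp n (τ ω) ≤ t} = {ω | τ ω < c} := by
    ext ω
    simp only [mem_ofPred_eq, ← Subtype.coe_le_coe, ← Subtype.coe_lt_coe, coe_roundUp, hc]
    have htT : (t : ℝ) < T := lt_of_le_of_ne t.2.2 ht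
    rw [min_le_iff, or_iff_right htT.not_ge, div_le_iff₀ hn, lt_div_iff₀ hn]
    rw [← Nat.floor_lt (mul_nonneg (τ ω).2.1 hn.le)]
    have h0 : (0 : ℝ) ≤ (t : ℝ) * (n + 1) := mul_nonneg t.2.1 hn.le
    rw [← Nat.cast_add_one, ← Nat.le_floor_iff h0, Nat.succ_le_iff]
  rw [hset]
  exact 𝓕.mono hct _ (hτ.measurableSet_lt c)

/-- A right-continuous adapted real process is progressively measurable. -/
theorem isStronglyProgressive_of_continuousWithinAt_Ici {N : Time T → Ω → ℝ}
    (hN : StronglyAdapted 𝓕 N) (hr : ∀ ω t, ContinuousWithinAt (fun s => N s ω) (Ici t) t) :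
    IsStronglyProgressive 𝓕 N := by
  intro i
  let _ : MeasurableSpace Ω := 𝓕 i
  have hlim : ∀ p : Iic i × Ω, Tendsto (fun n => N (min (roundUp n (p.1 : Time T)) i) p.2) atTop
      (𝓝 (N p.1 p.2)) := by
    rintro ⟨⟨s, hs⟩, ω⟩
    refine (hr ω s).tendsto.comp ?_
    rw [tendsto_nhdsWithin_iff]
    refine ⟨?_, Eventually.of_forall fun n => le_min (le_roundUp n s) hs⟩
    have h1 := ((tendsto_roundUp s).mono_right nhdsWithin_le_nhds).min
      (tendsto_const_nhds (x := i))
    rwa [min_eq_left (show s ≤ i from hs)] at h1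
  refine stronglyMeasurable_of_tendsto atTop (fun n => ?_) (tendsto_pi_nhds.2 hlim)
  refine Measurable.stronglyMeasurable ?_
  set ρ : Iic i → Time T := fun s => min (roundUp n (s : Time T)) i with hρ
  have hρm : Measurable ρ := ((measurable_roundUp n).comp measurable_subtype_coe).min
    measurable_const
  have hρc : (range ρ).Countable := by
    refine ((countable_range_roundUp (T := T) n).image fun s => min s i).mono ?_
    rintro _ ⟨s, rfl⟩
    exact ⟨_, ⟨s, rfl⟩, rfl⟩
  intro B hB
  have hset : (fun p : Iic i × Ω => N (min (roundUp n (p.1 : Time T)) i) p.2) ⁻¹' B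
      = ⋃ r ∈ range ρ, (ρ ⁻¹' {r}) ×ˢ (N r ⁻¹' B) := by
    ext ⟨s, ω⟩
    simp only [mem_preimage, mem_iUnion, mem_prod, mem_singleton_iff, exists_prop]
    exact ⟨fun h => ⟨ρ s, ⟨s, rfl⟩, rfl, h⟩, fun ⟨r, _, hr, h⟩ => by
      rwa [← hr] at h⟩
  rw [hset]
  refine MeasurableSet.biUnion hρc ?_
  rintro r ⟨s, rfl⟩
  have hle : ρ s ≤ i := min_le_right _ _
  exact (hρm (measurableSet_singleton _)).prod
    (((hN (ρ s)).mono (𝓕.mono hle)).measurable hB)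

end RoundUp

/-! ### Optional stopping and jumps of martingales at predictable times -/

section Martingales

variable {Ω : Type*} [mΩ : MeasurableSpace Ω] {T : ℝ} [Fact (0 ≤ T)] {P : Measure Ω}
  {𝓕 : Filtration (Time T) mΩ}

/-- Optional stopping for right-continuous martingales on `[0, T]`. -/
theorem stoppedValue_ae_eq_condExp [IsProbabilityMeasure P] {N : Time T → Ω → ℝ}
    (hN : Martingale N 𝓕 P)
    (hr : ∀ ω t, ContinuousWithinAt (fun s => N s ω) (Ici t) t)
    {τ : Ω → Time T} (hτ : IsStopping 𝓕 τ) :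
    (fun ω => N (τ ω) ω) =ᵐ[P] P[N ⊤ | IsStoppingTime.measurableSpace hτ] := by
  have hX : Integrable (N ⊤) P := hN.integrable ⊤
  have hle : IsStoppingTime.measurableSpace hτ ≤ mΩ := IsStoppingTime.measurableSpace_le hτ
  have hmeas : StronglyMeasurable[IsStoppingTime.measurableSpace hτ] (fun ω => N (τ ω) ω) :=
    (measurable_stoppedValue
      (isStronglyProgressive_of_continuousWithinAt_Ici hN.stronglyAdapted hr) hτ).stronglyMeasurable
  -- the discretized stopping times
  have hρ : ∀ n, IsStopping 𝓕 (fun ω => roundUp n (τ ω)) := fun n => hτ.roundUp_comp n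
  have hdisc : ∀ n, (fun ω => N (roundUp n (τ ω)) ω)
      =ᵐ[P] P[N ⊤ | IsStoppingTime.measurableSpace (hρ n)] := fun n => by
    refine hN.stoppedValue_ae_eq_condExp_of_le_const_of_countable_range (hρ n)
      (fun ω => WithTop.coe_le_coe.2 le_top) ?_
    refine ((countable_range_roundUp (T := T) n).image fun s => (s : WithTop (Time T))).mono ?_
    rintro _ ⟨ω, rfl⟩
    exact ⟨_, ⟨τ ω, rfl⟩, rfl⟩
  have hUI : UniformIntegrable (fun n ω => N (roundUp n (τ ω)) ω) 1 P :=
    UniformIntegrable.ae_eq (hX.uniformIntegrable_condExp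
      fun n => IsStoppingTime.measurableSpace_le (hρ n)) fun n => (hdisc n).symm
  have hlim : ∀ ω, Tendsto (fun n => N (roundUp n (τ ω)) ω) atTop (𝓝 (N (τ ω) ω)) := fun ω =>
    (hr ω (τ ω)).tendsto.comp (tendsto_roundUp (τ ω))
  have hLp : MemLp (fun ω => N (τ ω) ω) 1 P :=
    hUI.memLp_of_ae_tendsto (Eventually.of_forall hlim)
  have hL1 := tendsto_Lp_finite_of_tendsto_ae le_rfl ENNReal.one_ne_top hUI.1 hLp hUI.2.1
    (Eventually.of_forall hlim)
  refine ae_eq_condExp_of_forall_setIntegral_eq hle hX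
    (fun s _ _ => (hLp.integrable le_rfl).integrableOn) (fun s hs _ => ?_)
    hmeas.aestronglyMeasurable
  have hint := tendsto_setIntegral_of_L1' (fun ω => N (τ ω) ω) hLp.1
    (Eventually.of_forall fun n => (hUI.memLp n).integrable le_rfl) hL1 s
  refine tendsto_nhds_unique hint (tendsto_const_nhds.congr fun n => ?_)
  have hsn : MeasurableSet[IsStoppingTime.measurableSpace (hρ n)] s :=
    IsStoppingTime.measurableSpace_mono hτ (hρ n)
      (fun ω => WithTop.coe_le_coe.2 (le_roundUp n (τ ω))) s hs
  rw [← setIntegral_condExp (IsStoppingTime.measurableSpace_le (hρ n)) hX hsn]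
  exact setIntegral_congr_ae (IsStoppingTime.measurableSpace_le (hρ n) s hsn)
    ((hdisc n).mono fun ω h _ => h.symm)

/-- The announcing sequence of a predictable time can be chosen increasing, and bounded by the
time, without exceptional null set. -/
theorem IsPredictableTime.exists_monotone_announcing {τ : Ω → Time T}
    (hτ : IsPredictableTime P 𝓕 τ) :
    ∃ σ : ℕ → Ω → Time T, (∀ n, IsStopping 𝓕 (σ n)) ∧ Monotone σ ∧ (∀ n, σ n ≤ τ) ∧
      ∀ᵐ ω ∂P, (⊥ < τ ω → ∀ n, σ n ω < τ ω) ∧ Tendsto (fun n => σ n ω) atTop (𝓝 (τ ω)) := by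
  obtain ⟨hst, σ, hσ, hae⟩ := hτ
  refine ⟨fun n ω => min (partialSups σ n ω) (τ ω),
    fun n => (IsStopping.partialSups hσ n).min hst,
    fun m n hmn ω => min_le_min_right _ ((partialSups σ).mono hmn ω),
    fun n ω => min_le_right _ _, ?_⟩
  filter_upwards [hae] with ω ⟨hmono, hlt, hlim⟩
  have hsup : ∀ n, partialSups σ n ω = σ n ω := by
    intro n
    induction n with
    | zero => simp
    | succ n ih =>
      rw [partialSups_add_one, Pi.sup_apply, ih]
      exact sup_eq_right.2 (hmono n.le_succ)
  have hle : ∀ n, σ n ω ≤ τ ω := fun n => hmono.ge_of_tendsto hlim n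
  simp only [hsup, min_eq_left (hle _)]
  exact ⟨hlt, hlim⟩

/-- A sequence announcing `τ` carries all the information of `𝓕_{τ-}`. -/
theorem sigmaAlgebraBefore_le_iSup (h_usual : UsualConditions P 𝓕) {τ : Ω → Time T}
    {σ : ℕ → Ω → Time T} (hσ : ∀ n, IsStopping 𝓕 (σ n)) (hle : ∀ n, σ n ≤ τ)
    (hlim : ∀ᵐ ω ∂P, Tendsto (fun n => σ n ω) atTop (𝓝 (τ ω))) :
    sigmaAlgebraBefore 𝓕 τ ≤ ⨆ n, IsStoppingTime.measurableSpace (hσ n) := by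
  have hbot : ∀ A, MeasurableSet[𝓕 ⊥] A →
      MeasurableSet[⨆ n, IsStoppingTime.measurableSpace (hσ n)] A := fun A hA =>
    le_iSup (fun n => IsStoppingTime.measurableSpace (hσ n)) 0 A
      (IsStoppingTime.le_measurableSpace_of_const_le (hσ 0)
        (fun ω => WithTop.coe_le_coe.2 bot_le) A hA)
  refine MeasurableSpace.generateFrom_le ?_
  rintro B (hB | ⟨t, A, hA, rfl⟩)
  · exact hbot B hB
  have hpiece : ∀ n, MeasurableSet[⨆ n, IsStoppingTime.measurableSpace (hσ n)]
      (A ∩ {ω | t < σ n ω}) := by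
    intro n
    refine le_iSup (fun n => IsStoppingTime.measurableSpace (hσ n)) n _ ?_
    have ht : MeasurableSet[𝓕 t] (A ∩ {ω | t < σ n ω}) := by
      have := (isStopping_iff.1 (hσ n) t).compl
      refine hA.inter ?_
      convert this using 1
      ext ω
      simp
    refine (IsStoppingTime.measurableSet (hσ n) _).2
      ⟨le_iSup (fun t => (𝓕 t : MeasurableSpace Ω)) t _ ht, fun i => ?_⟩
    by_cases hti : t ≤ i
    · exact (𝓕.mono hti _ ht).inter (hσ n i)
    · convert MeasurableSet.empty
      ext ω
      simp only [WithTop.coe_le_coe, mem_inter_iff, mem_ofPred_eq, mem_empty_iff_false, iff_false]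
      rintro ⟨⟨-, h1⟩, h2⟩
      exact hti (h1.le.trans h2)
  have hdiff : MeasurableSet[⨆ n, IsStoppingTime.measurableSpace (hσ n)]
      ((A ∩ {ω | t < τ ω}) \ ⋃ n, A ∩ {ω | t < σ n ω}) := by
    refine hbot _ (h_usual.complete _ (measure_mono_null ?_ (ae_iff.1 hlim)))
    rintro ω ⟨⟨hωA, hωt⟩, hω⟩ hω'
    obtain ⟨n, hn⟩ := (hω'.eventually (lt_mem_nhds hωt)).exists
    exact hω (mem_iUnion.2 ⟨n, hωA, hn⟩)
  have hunion : A ∩ {ω | t < τ ω} = (⋃ n, A ∩ {ω | t < σ n ω}) ∪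
      ((A ∩ {ω | t < τ ω}) \ ⋃ n, A ∩ {ω | t < σ n ω}) := by
    refine (union_sdiff_cancel (iUnion_subset fun n => ?_)).symm
    exact inter_subset_inter_right _ fun ω (hω : t < σ n ω) => hω.trans_le (hle n ω)
  rw [hunion]
  exact (MeasurableSet.iUnion hpiece).union hdiff

/-- A càdlàg martingale does not jump at predictable times if the filtration is quasi-left
continuous: by optional stopping and Lévy's upward theorem, its left limit at `τ` is the
conditional expectation given `𝓕_{τ-}`, and its value is the one given `𝓕_τ`. -/
theorem jump_martingale_eq_zero_of_forall [IsProbabilityMeasure P] (h_usual : UsualConditions P 𝓕)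
    (h_qlc : QuasiLeftContinuous P 𝓕) {N : Time T → Ω → ℝ} (hN : Martingale N 𝓕 P)
    (hc : ∀ ω, IsCadlag (fun t => N t ω)) {τ : Ω → Time T} (hτ : IsPredictableTime P 𝓕 τ) :
    ∀ᵐ ω ∂P, jump (fun t => N t ω) (τ ω) = 0 := by
  have hr : ∀ ω t, ContinuousWithinAt (fun s => N s ω) (Ici t) t := fun ω t => (hc ω t).1
  obtain ⟨σ, hσ, hmono, hle, hae⟩ := hτ.exists_monotone_announcing
  let 𝓖 : Filtration ℕ mΩ :=
    { seq := fun n => IsStoppingTime.measurableSpace (hσ n)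
      mono' := fun m n hmn => IsStoppingTime.measurableSpace_mono (hσ m) (hσ n)
        fun ω => WithTop.coe_le_coe.2 (hmono hmn ω)
      le' := fun n => IsStoppingTime.measurableSpace_le (hσ n) }
  have hsup : (⨆ n, (𝓖 n : MeasurableSpace Ω)) = IsStoppingTime.measurableSpace hτ.1 := by
    refine le_antisymm (iSup_le fun n => ?_) ?_
    · exact IsStoppingTime.measurableSpace_mono (hσ n) hτ.1
        fun ω => WithTop.coe_le_coe.2 (hle n ω)
    · rw [h_qlc τ hτ.1 hτ]
      exact sigmaAlgebraBefore_le_iSup h_usual hσ hle (hae.mono fun ω h => h.2)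
  have hlevy := tendsto_ae_condExp (μ := P) (ℱ := 𝓖) (N ⊤)
  rw [hsup] at hlevy
  have hsampled : ∀ᵐ ω ∂P, ∀ n, N (σ n ω) ω = (P[N ⊤ | 𝓖 n]) ω :=
    ae_all_iff.2 fun n => stoppedValue_ae_eq_condExp hN hr (hσ n)
  filter_upwards [hlevy, hsampled, stoppedValue_ae_eq_condExp hN hr hτ.1, hae]
    with ω h1 h2 h3 ⟨hlt, hlim⟩
  rcases eq_bot_or_bot_lt (τ ω) with h0 | h0
  · rw [h0]
    exact jump_bot _
  have hleft : Tendsto (fun n => σ n ω) atTop (𝓝[<] τ ω) :=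
    tendsto_nhdsWithin_iff.2 ⟨hlim, Eventually.of_forall (hlt h0)⟩
  have h4 := ((hc ω).tendsto_leftLim (τ ω)).comp hleft
  have h5 : Tendsto (fun n => N (σ n ω) ω) atTop (𝓝 (N (τ ω) ω)) := by
    simp only [h2]
    rw [h3]
    exact h1
  rw [jump, sub_eq_zero]
  exact tendsto_nhds_unique h5 h4

theorem jump_martingale_eq_zero [IsProbabilityMeasure P] (h_usual : UsualConditions P 𝓕)
    (h_qlc : QuasiLeftContinuous P 𝓕) {N : Time T → Ω → ℝ} (hN : Martingale N 𝓕 P)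
    (hc : ∀ᵐ ω ∂P, IsCadlag (fun t => N t ω)) {τ : Ω → Time T}
    (hτ : IsPredictableTime P 𝓕 τ) :
    ∀ᵐ ω ∂P, jump (fun t => N t ω) (τ ω) = 0 := by
  classical
  set Z : Set Ω := {ω | ¬ IsCadlag (fun t => N t ω)} with hZ
  have hZ0 : P Z = 0 := ae_iff.1 hc
  -- the paths in the null set `Z` are replaced by `0`
  set N' : Time T → Ω → ℝ := fun t => Zᶜ.indicator (N t) with hN'
  have hNN' : ∀ ω ∉ Z, (fun t => N' t ω) = fun t => N t ω := fun ω hω => by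
    funext t
    exact indicator_of_mem (s := Zᶜ) hω _
  have hmart : Martingale N' 𝓕 P := by
    refine hN.congr (fun t => (hN.stronglyAdapted t).indicator
      (h_usual.measurableSet_of_null t hZ0).compl) fun t => ?_
    filter_upwards [hc] with ω hω
    exact (congrFun (hNN' ω (fun h => h hω)) t).symm
  have hcad : ∀ ω, IsCadlag (fun t => N' t ω) := by
    intro ω
    by_cases hω : ω ∈ Z
    · have : (fun t => N' t ω) = fun _ => 0 := by
        funext t
        exact indicator_of_notMem (s := Zᶜ) (fun h => h hω) _
      rw [this]
      exact isCadlag_const 0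
    · rw [hNN' ω hω]
      exact not_not.1 hω
  filter_upwards [jump_martingale_eq_zero_of_forall h_usual h_qlc hmart hcad hτ, hc] with ω hω hωc
  rwa [hNN' ω (fun h => h hωc)] at hω

theorem jump_localMartingale_eq_zero [IsProbabilityMeasure P] (h_usual : UsualConditions P 𝓕)
    (h_qlc : QuasiLeftContinuous P 𝓕) {M : Time T → Ω → ℝ}
    (hM : IsLocalMartingaleZero P 𝓕 M) {τ : Ω → Time T} (hτ : IsPredictableTime P 𝓕 τ) :
    ∀ᵐ ω ∂P, jump (fun t => M t ω) (τ ω) = 0 := by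
  obtain ⟨ρ, hρ, hmart⟩ := hM.locallyMartingale
  have hjump : ∀ᵐ ω ∂P, ∀ n, jump (fun t =>
      stoppedProcess (fun i => {ω | ⊥ < ρ n ω}.indicator (M i)) (ρ n) t ω) (τ ω) = 0 := by
    refine ae_all_iff.2 fun n => jump_martingale_eq_zero h_usual h_qlc (hmart n) ?_ hτ
    filter_upwards [hM.cadlagAdapted.cadlag] with ω hω
    by_cases hpos : ⊥ < ρ n ω
    · have hfun : (fun t => stoppedProcess (fun i => {ω | ⊥ < ρ n ω}.indicator (M i)) (ρ n) t ω)
          = fun t : Time T => M (min (t : WithTop (Time T)) (ρ n ω)).untopA ω := by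
        funext t
        exact indicator_of_mem (s := {ω | ⊥ < ρ n ω}) hpos _
      rw [hfun]
      cases hρω : ρ n ω with
      | top => simpa using hω
      | coe r =>
        simp only [← WithTop.coe_min]
        exact hω.comp_min r
    · have hfun : (fun t => stoppedProcess (fun i => {ω | ⊥ < ρ n ω}.indicator (M i)) (ρ n) t ω)
          = fun _ => 0 := by
        funext t
        exact indicator_of_notMem (s := {ω | ⊥ < ρ n ω}) hpos _
      rw [hfun]
      exact isCadlag_const 0
  filter_upwards [hjump, hρ.tendsto_top] with ω hω hlim
  -- `⊤` is isolated in `[0, T] ∪ {⊤}`, so the path is eventually not stopped at all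
  have hev : ∀ᶠ n in atTop, ((⊤ : Time T) : WithTop (Time T)) < ρ n ω :=
    hlim.eventually (lt_mem_nhds (WithTop.coe_lt_top _))
  obtain ⟨n, hn⟩ := hev.exists
  have hfun : (fun t => stoppedProcess (fun i => {ω | ⊥ < ρ n ω}.indicator (M i)) (ρ n) t ω)
      = fun t => M t ω := by
    funext t
    rw [stoppedProcess_eq_of_le ((WithTop.coe_le_coe.2 le_top).trans hn.le)]
    exact indicator_of_mem (s := {ω | ⊥ < ρ n ω}) (bot_le.trans_lt hn) _
  have := hω n
  rwa [hfun] at this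

end Martingales

/-! ### Foreseeable random closed sets -/

section Foreseeable

/-- Events defined through two countably valued random variables are measurable. -/
theorem measurableSet_setOf_of_countable_range {Ω α β : Type*} {m : MeasurableSpace Ω}
    {X : Ω → α} {Y : Ω → β} (hc : (range X).Countable)
    (hX : ∀ p : α → Prop, MeasurableSet {ω | p (X ω)})
    (hY : ∀ p : β → Prop, MeasurableSet {ω | p (Y ω)}) (q : α → β → Prop) :
    MeasurableSet {ω | q (X ω) (Y ω)} := by
  have hset : {ω | q (X ω) (Y ω)} = ⋃ x ∈ range X, {ω | X ω = x} ∩ {ω | q x (Y ω)} := by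
    ext ω
    simp only [mem_ofPred_eq, mem_iUnion, mem_inter_iff, exists_prop]
    exact ⟨fun h => ⟨X ω, ⟨ω, rfl⟩, rfl, h⟩, fun ⟨x, _, hx, h⟩ => by rwa [← hx] at h⟩
  rw [hset]
  exact MeasurableSet.biUnion hc fun x _ => (hX (· = x)).inter (hY (q x))

variable {Ω : Type*} [mΩ : MeasurableSpace Ω] {T : ℝ}

/-- A random closed subset `C` of `[0, T]` with countably many values whose part in `[0, t + δ]` is
known at time `t`, for some `δ > 0` independent of `t`: it can be foreseen by `δ`. -/
structure IsForeseeable (𝓕 : Filtration (Time T) mΩ) (C : Ω → Set (Time T)) : Prop where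
  isClosed : ∀ ω, IsClosed (C ω)
  countable_range : (range C).Countable
  exists_delta : ∃ δ : ℝ, 0 < δ ∧ ∀ (t : Time T) (p : Set (Time T) → Prop),
    MeasurableSet[𝓕 t] {ω | p (C ω ∩ {s | (s : ℝ) ≤ t + δ})}

/-- Countable decreasing intersections of foreseeable random sets. -/
def IsLimitForeseeable (𝓕 : Filtration (Time T) mΩ) (C : Ω → Set (Time T)) : Prop :=
  ∃ D : ℕ → Ω → Set (Time T), (∀ n, IsForeseeable 𝓕 (D n)) ∧
    ∀ ω, Antitone (fun n => D n ω) ∧ C ω = ⋂ n, D n ω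

variable {𝓕 : Filtration (Time T) mΩ} {C D : Ω → Set (Time T)}

/-- What is foreseen by `δ` is foreseen by any smaller `η`. -/
theorem measurableSet_foreseen_mono {δ η : ℝ} (hη : η ≤ δ)
    (h : ∀ (t : Time T) (p : Set (Time T) → Prop),
      MeasurableSet[𝓕 t] {ω | p (C ω ∩ {s | (s : ℝ) ≤ t + δ})})
    (t : Time T) (p : Set (Time T) → Prop) :
    MeasurableSet[𝓕 t] {ω | p (C ω ∩ {s | (s : ℝ) ≤ t + η})} := by
  have := h t fun F => p (F ∩ {s | (s : ℝ) ≤ t + η})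
  have hsub : {s : Time T | (s : ℝ) ≤ t + η} ⊆ {s : Time T | (s : ℝ) ≤ t + δ} :=
    fun s (hs : (s : ℝ) ≤ t + η) => hs.trans (by linarith)
  simpa only [inter_assoc, inter_eq_self_of_subset_right hsub] using this

theorem IsForeseeable.map₂ (hC : IsForeseeable 𝓕 C) (hD : IsForeseeable 𝓕 D)
    (op : Set (Time T) → Set (Time T) → Set (Time T))
    (hop : ∀ F G W, op F G ∩ W = op (F ∩ W) (G ∩ W) ∩ W)
    (hcl : ∀ F G, IsClosed F → IsClosed G → IsClosed (op F G)) :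
    IsForeseeable 𝓕 (fun ω => op (C ω) (D ω)) := by
  obtain ⟨δ, hδ, hCδ⟩ := hC.exists_delta
  obtain ⟨δ', hδ', hDδ⟩ := hD.exists_delta
  refine ⟨fun ω => hcl _ _ (hC.isClosed ω) (hD.isClosed ω), ?_, min δ δ', lt_min hδ hδ',
    fun t p => ?_⟩
  · refine ((hC.countable_range.prod hD.countable_range).image fun x => op x.1 x.2).mono ?_
    rintro _ ⟨ω, rfl⟩
    exact ⟨(C ω, D ω), ⟨⟨ω, rfl⟩, ⟨ω, rfl⟩⟩, rfl⟩
  · have hcount : (range fun ω => C ω ∩ {s | (s : ℝ) ≤ t + min δ δ'}).Countable := by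
      refine (hC.countable_range.image fun F => F ∩ {s | (s : ℝ) ≤ t + min δ δ'}).mono ?_
      rintro _ ⟨ω, rfl⟩
      exact ⟨C ω, ⟨ω, rfl⟩, rfl⟩
    simp only [hop (C _) (D _)]
    exact measurableSet_setOf_of_countable_range hcount
      (measurableSet_foreseen_mono (min_le_left _ _) hCδ t)
      (measurableSet_foreseen_mono (min_le_right _ _) hDδ t)
      fun F G => p (op F G ∩ {s | (s : ℝ) ≤ t + min δ δ'})

theorem IsForeseeable.union (hC : IsForeseeable 𝓕 C) (hD : IsForeseeable 𝓕 D) :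
    IsForeseeable 𝓕 (fun ω => C ω ∪ D ω) :=
  hC.map₂ hD (· ∪ ·) (fun F G W => by ext; simp; tauto) fun _ _ hF hG => hF.union hG

theorem IsForeseeable.inter (hC : IsForeseeable 𝓕 C) (hD : IsForeseeable 𝓕 D) :
    IsForeseeable 𝓕 (fun ω => C ω ∩ D ω) :=
  hC.map₂ hD (· ∩ ·) (fun F G W => by ext; simp; tauto) fun _ _ hF hG => hF.inter hG

theorem isForeseeable_const {F : Set (Time T)} (hF : IsClosed F) :
    IsForeseeable 𝓕 (fun _ => F) :=
  ⟨fun _ => hF, (countable_singleton F).mono range_const_subset, 1, one_pos,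
    fun _ _ => MeasurableSet.const _⟩

/-- A deterministic closed set, restricted to an event of `𝓕 i`, is foreseeable if it starts at
`i + δ` or later, or if `i` is the initial time. -/
theorem isForeseeable_of_measurableSet {F : Set (Time T)} (hF : IsClosed F) {i : Time T} {δ : ℝ}
    (hδ : 0 < δ) (hFi : ∀ t < i, ∀ s ∈ F, (t : ℝ) + δ < s) {A : Set Ω}
    (hA : MeasurableSet[𝓕 i] A) : IsForeseeable 𝓕 (fun ω => {s | s ∈ F ∧ ω ∈ A}) := by
  have hval : ∀ ω, {s | s ∈ F ∧ ω ∈ A} = F ∨ {s | s ∈ F ∧ ω ∈ A} = ∅ := fun ω => by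
    by_cases hω : ω ∈ A
    · exact Or.inl (by ext; simp [hω])
    · exact Or.inr (by ext; simp [hω])
  refine ⟨fun ω => ?_, ?_, δ, hδ, fun t p => ?_⟩
  · rcases hval ω with h | h <;> rw [h]
    · exact hF
    · exact isClosed_empty
  · refine (Set.toFinite {F, ∅}).countable.mono ?_
    rintro _ ⟨ω, rfl⟩
    exact hval ω
  · by_cases hti : t < i
    · have hempty : ∀ ω, {s | s ∈ F ∧ ω ∈ A} ∩ {s | (s : ℝ) ≤ t + δ} = ∅ := fun ω =>
        eq_empty_of_forall_notMem fun s hs => absurd hs.2 (not_le.2 (hFi t hti s hs.1.1))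
      simp only [hempty]
      exact MeasurableSet.const _
    · have hA' := 𝓕.mono (not_lt.1 hti) _ hA
      have hset : {ω | p ({s | s ∈ F ∧ ω ∈ A} ∩ {s | (s : ℝ) ≤ t + δ})}
          = (A ∩ {_ω | p (F ∩ {s | (s : ℝ) ≤ t + δ})}) ∪ (Aᶜ ∩ {_ω | p ∅}) := by
        ext ω
        by_cases hω : ω ∈ A <;> simp [hω]
      rw [hset]
      exact (hA'.inter (MeasurableSet.const _)).union (hA'.compl.inter (MeasurableSet.const _))

theorem IsForeseeable.measurableSet_mem [Fact (0 ≤ T)] (hC : IsForeseeable 𝓕 C) {τ : Ω → Time T}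
    (hτ : Measurable τ) : MeasurableSet {ω | τ ω ∈ C ω} := by
  obtain ⟨δ, hδ, hCδ⟩ := hC.exists_delta
  have hall : ∀ F : Set (Time T), F ∩ {s | (s : ℝ) ≤ (⊤ : Time T) + δ} = F := fun F =>
    inter_eq_left.2 fun s _ => by
      have : (s : ℝ) ≤ (⊤ : Time T) := le_top (a := s)
      exact this.trans (by linarith)
  have hset : {ω | τ ω ∈ C ω} = ⋃ F ∈ range C, {ω | C ω = F} ∩ τ ⁻¹' F := by
    ext ω
    simp only [mem_ofPred_eq, mem_iUnion, mem_inter_iff, mem_preimage, exists_prop]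
    exact ⟨fun h => ⟨C ω, ⟨ω, rfl⟩, rfl, h⟩, fun ⟨F, _, hF, h⟩ => by rwa [← hF] at h⟩
  rw [hset]
  refine MeasurableSet.biUnion hC.countable_range ?_
  rintro _ ⟨ω, rfl⟩
  refine MeasurableSet.inter ?_ (hτ (hC.isClosed ω).measurableSet)
  have := hCδ ⊤ (· = C ω)
  simp only [hall] at this
  exact 𝓕.le _ _ this

theorem isLimitForeseeable_iInter {E : ℕ → Ω → Set (Time T)} (hE : ∀ n, IsForeseeable 𝓕 (E n)) :
    IsLimitForeseeable 𝓕 (fun ω => ⋂ n, E n ω) := by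
  refine ⟨fun n ω => dissipate (fun k => E k ω) n, fun n => ?_, fun ω =>
    ⟨antitone_dissipate, iInter_dissipate.symm⟩⟩
  induction n with
  | zero => simpa using hE 0
  | succ n ih =>
    simp only [dissipate_succ]
    exact ih.inter (hE (n + 1))

theorem IsForeseeable.isLimitForeseeable (hC : IsForeseeable 𝓕 C) : IsLimitForeseeable 𝓕 C :=
  ⟨fun _ => C, fun _ => hC, fun _ => ⟨antitone_const, (iInter_const _).symm⟩⟩

theorem IsLimitForeseeable.iInter {E : ℕ → Ω → Set (Time T)}
    (hE : ∀ n, IsLimitForeseeable 𝓕 (E n)) : IsLimitForeseeable 𝓕 (fun ω => ⋂ n, E n ω) := by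
  choose D hD hDE using hE
  have := isLimitForeseeable_iInter (𝓕 := 𝓕) (E := fun k => D k.unpair.1 k.unpair.2)
    fun k => hD _ _
  convert this using 2 with ω
  simp only [fun n => (hDE n ω).2]
  exact (iInter_unpair fun i j => D i j ω).symm

theorem IsLimitForeseeable.union (hC : IsLimitForeseeable 𝓕 C) (hD : IsLimitForeseeable 𝓕 D) :
    IsLimitForeseeable 𝓕 (fun ω => C ω ∪ D ω) := by
  obtain ⟨E, hE, hEC⟩ := hC
  obtain ⟨E', hE', hED⟩ := hD
  refine ⟨fun n ω => E n ω ∪ E' n ω, fun n => (hE n).union (hE' n), fun ω => ⟨?_, ?_⟩⟩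
  · exact fun m n hmn => union_subset_union ((hEC ω).1 hmn) ((hED ω).1 hmn)
  · simp only [(hEC ω).2, (hED ω).2]
    rw [iInter_union_of_antitone (hEC ω).1 (hED ω).1]

theorem IsLimitForeseeable.accumulate {E : ℕ → Ω → Set (Time T)}
    (hE : ∀ n, IsLimitForeseeable 𝓕 (E n)) (n : ℕ) :
    IsLimitForeseeable 𝓕 (fun ω => accumulate (fun k => E k ω) n) := by
  induction n with
  | zero => simpa using hE 0
  | succ n ih =>
    simp only [accumulate_succ]
    exact ih.union (hE (n + 1))

theorem IsLimitForeseeable.measurableSet_mem [Fact (0 ≤ T)] (hC : IsLimitForeseeable 𝓕 C)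
    {τ : Ω → Time T} (hτ : Measurable τ) : MeasurableSet {ω | τ ω ∈ C ω} := by
  obtain ⟨D, hD, hDC⟩ := hC
  have : {ω | τ ω ∈ C ω} = ⋂ n, {ω | τ ω ∈ D n ω} := by
    ext ω
    simp [(hDC ω).2]
  rw [this]
  exact MeasurableSet.iInter fun n => (hD n).measurableSet_mem hτ

end Foreseeable

/-! ### Inner approximation of predictable sets along a random time -/

section InnerApproximation

variable {Ω : Type*} [mΩ : MeasurableSpace Ω] {T : ℝ}

/-- Along the graph of the random time `τ`, the set `B` is approximated from inside by countable
intersections of foreseeable random sets. -/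
def IsInnerApproximable (P : Measure Ω) (𝓕 : Filtration (Time T) mΩ) (τ : Ω → Time T)
    (B : Set (Time T × Ω)) : Prop :=
  ∀ ε : ENNReal, 0 < ε → ∃ C : Ω → Set (Time T), IsLimitForeseeable 𝓕 C ∧
    (∀ ω, ∀ s ∈ C ω, (s, ω) ∈ B) ∧ P {ω | (τ ω, ω) ∈ B ∧ τ ω ∉ C ω} ≤ ε

variable {P : Measure Ω} {𝓕 : Filtration (Time T) mΩ} {τ : Ω → Time T}

theorem IsForeseeable.isInnerApproximable {C : Ω → Set (Time T)} (hC : IsForeseeable 𝓕 C) :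
    IsInnerApproximable P 𝓕 τ {x | x.1 ∈ C x.2} := fun ε _ =>
  ⟨C, hC.isLimitForeseeable, fun _ _ hs => hs, by simp⟩

theorem IsInnerApproximable.iInter {B : ℕ → Set (Time T × Ω)}
    (hB : ∀ n, IsInnerApproximable P 𝓕 τ (B n)) : IsInnerApproximable P 𝓕 τ (⋂ n, B n) := by
  intro ε hε
  obtain ⟨ε', hε'pos, hε'sum⟩ := ENNReal.exists_pos_sum_of_countable' hε.ne' ℕ
  choose C hC hCB hCP using fun n => hB n (ε' n) (hε'pos n)
  refine ⟨fun ω => ⋂ n, C n ω, IsLimitForeseeable.iInter hC, fun ω s hs => ?_, ?_⟩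
  · exact mem_iInter.2 fun n => hCB n ω s (mem_iInter.1 hs n)
  · calc P {ω | (τ ω, ω) ∈ ⋂ n, B n ∧ τ ω ∉ ⋂ n, C n ω}
        ≤ P (⋃ n, {ω | (τ ω, ω) ∈ B n ∧ τ ω ∉ C n ω}) := by
          refine measure_mono ?_
          rintro ω ⟨h1, h2⟩
          simp only [mem_iInter, not_forall] at h1 h2
          obtain ⟨n, hn⟩ := h2
          exact mem_iUnion.2 ⟨n, h1 n, hn⟩
      _ ≤ ∑' n, P {ω | (τ ω, ω) ∈ B n ∧ τ ω ∉ C n ω} := measure_iUnion_le _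
      _ ≤ ∑' n, ε' n := ENNReal.tsum_le_tsum hCP
      _ ≤ ε := hε'sum.le

theorem IsInnerApproximable.iUnion [Fact (0 ≤ T)] [IsProbabilityMeasure P] (hτ : Measurable τ)
    {B : ℕ → Set (Time T × Ω)}
    (hB : ∀ n, IsInnerApproximable P 𝓕 τ (B n)) : IsInnerApproximable P 𝓕 τ (⋃ n, B n) := by
  intro ε hε
  have hε2 : 0 < ε / 2 := ENNReal.half_pos hε.ne'
  obtain ⟨ε', hε'pos, hε'sum⟩ := ENNReal.exists_pos_sum_of_countable' hε2.ne' ℕ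
  choose C hC hCB hCP using fun n => hB n (ε' n) (hε'pos n)
  -- finitely many of the `C n` exhaust their union up to a small probability
  have hacc : ∀ N, IsLimitForeseeable 𝓕 (fun ω => accumulate (fun n => C n ω) N) :=
    IsLimitForeseeable.accumulate hC
  have hlim : Tendsto (fun N => P {ω | τ ω ∈ (⋃ n, C n ω) ∧ τ ω ∉ accumulate (fun n => C n ω) N})
      atTop (𝓝 0) := by
    have hmeas : ∀ N, MeasurableSet
        {ω | τ ω ∈ (⋃ n, C n ω) ∧ τ ω ∉ accumulate (fun n => C n ω) N} := by
      intro N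
      have h1 : MeasurableSet {ω | τ ω ∈ ⋃ n, C n ω} := by
        simp only [mem_iUnion, ofPred_exists]
        exact MeasurableSet.iUnion fun n => (hC n).measurableSet_mem hτ
      exact h1.inter ((hacc N).measurableSet_mem hτ).compl
    have hanti : Antitone fun N =>
        {ω | τ ω ∈ (⋃ n, C n ω) ∧ τ ω ∉ accumulate (fun n => C n ω) N} :=
      fun M N hMN ω hω => ⟨hω.1, fun h => hω.2 (monotone_accumulate hMN h)⟩
    have := tendsto_measure_iInter_atTop (μ := P) (fun N => (hmeas N).nullMeasurableSet) hanti
      ⟨0, measure_ne_top _ _⟩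
    have hempty : (⋂ N, {ω | τ ω ∈ (⋃ n, C n ω) ∧ τ ω ∉ accumulate (fun n => C n ω) N}) = ∅ := by
      refine eq_empty_of_forall_notMem fun ω hω => ?_
      rw [mem_iInter] at hω
      obtain ⟨n, hn⟩ := mem_iUnion.1 (hω 0).1
      exact (hω n).2 (subset_accumulate hn)
    rwa [hempty, measure_empty] at this
  obtain ⟨N, hN⟩ := (hlim.eventually (ge_mem_nhds hε2)).exists
  refine ⟨_, hacc N, fun ω s hs => ?_, ?_⟩
  · obtain ⟨n, _, hn⟩ := mem_accumulate.1 hs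
    exact mem_iUnion.2 ⟨n, hCB n ω s hn⟩
  · calc P {ω | (τ ω, ω) ∈ ⋃ n, B n ∧ τ ω ∉ accumulate (fun n => C n ω) N}
        ≤ P ((⋃ n, {ω | (τ ω, ω) ∈ B n ∧ τ ω ∉ C n ω}) ∪
            {ω | τ ω ∈ (⋃ n, C n ω) ∧ τ ω ∉ accumulate (fun n => C n ω) N}) := by
          refine measure_mono ?_
          rintro ω ⟨h1, h2⟩
          by_cases h : τ ω ∈ ⋃ n, C n ω
          · exact Or.inr ⟨h, h2⟩
          · obtain ⟨n, hn⟩ := mem_iUnion.1 h1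
            exact Or.inl (mem_iUnion.2 ⟨n, hn, fun h' => h (mem_iUnion.2 ⟨n, h'⟩)⟩)
      _ ≤ ∑' n, ε' n + ε / 2 := by
          refine (measure_union_le _ _).trans (add_le_add ?_ hN)
          exact (measure_iUnion_le _).trans (ENNReal.tsum_le_tsum hCP)
      _ ≤ ε / 2 + ε / 2 := by gcongr
      _ = ε := ENNReal.add_halves ε

theorem IsInnerApproximable.union [Fact (0 ≤ T)] [IsProbabilityMeasure P] (hτ : Measurable τ)
    {B B' : Set (Time T × Ω)} (hB : IsInnerApproximable P 𝓕 τ B)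
    (hB' : IsInnerApproximable P 𝓕 τ B') : IsInnerApproximable P 𝓕 τ (B ∪ B') := by
  have : B ∪ B' = ⋃ n : ℕ, if n = 0 then B else B' := by
    ext x
    simp only [mem_union, mem_iUnion]
    refine ⟨?_, ?_⟩
    · rintro (h | h)
      · exact ⟨0, by simpa using h⟩
      · exact ⟨1, by simpa using h⟩
    · rintro ⟨n, hn⟩
      split_ifs at hn
      · exact Or.inl hn
      · exact Or.inr hn
  rw [this]
  refine IsInnerApproximable.iUnion hτ fun n => ?_
  split_ifs
  · exact hB
  · exact hB'

theorem isInnerApproximable_singleton_bot_prod [Fact (0 ≤ T)] {A : Set Ω}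
    (hA : MeasurableSet[𝓕 ⊥] A) : IsInnerApproximable P 𝓕 τ ({⊥} ×ˢ A) := by
  have hfor := isForeseeable_of_measurableSet (𝓕 := 𝓕) (isClosed_singleton (x := (⊥ : Time T)))
    one_pos (fun t ht => absurd ht not_lt_bot) hA
  exact hfor.isInnerApproximable

theorem isInnerApproximable_Ioi_prod [Fact (0 ≤ T)] [IsProbabilityMeasure P] (hτ : Measurable τ)
    {i : Time T} {A : Set Ω} (hA : MeasurableSet[𝓕 i] A) :
    IsInnerApproximable P 𝓕 τ (Ioi i ×ˢ A) := by
  have hunion : Ioi i ×ˢ A = ⋃ n : ℕ, {x : Time T × Ω |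
      x.1 ∈ {s | x.1 ∈ {s : Time T | (i : ℝ) + 1 / (n + 1) ≤ s} ∧ x.2 ∈ A}} := by
    ext ⟨s, ω⟩
    simp only [mem_prod, mem_Ioi, mem_iUnion, mem_ofPred_eq, exists_and_right]
    refine and_congr_left fun _ => ⟨fun h => ?_, fun ⟨n, hn⟩ => ?_⟩
    · obtain ⟨n, hn⟩ := exists_nat_one_div_lt (sub_pos.2 (Subtype.coe_lt_coe.2 h))
      exact ⟨n, by linarith⟩
    · have : (0 : ℝ) < 1 / (n + 1) := by positivity
      exact Subtype.coe_lt_coe.1 (by linarith)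
  rw [hunion]
  refine IsInnerApproximable.iUnion hτ fun n => ?_
  have hpos : (0 : ℝ) < 1 / (n + 1) := by positivity
  refine (isForeseeable_of_measurableSet (F := {s : Time T | (i : ℝ) + 1 / (n + 1) ≤ s})
    (isClosed_le continuous_const continuous_subtype_val) hpos ?_ hA).isInnerApproximable
  intro t ht s hs
  have h1 : (t : ℝ) < i := ht
  have h2 : (i : ℝ) + 1 / (n + 1) ≤ s := hs
  linarith

/-- Every predictable set is approximated from inside by countable intersections of foreseeable
sets: the sets approximable together with their complements form a σ-algebra. -/
theorem isInnerApproximable_of_predictable [Fact (0 ≤ T)] [IsProbabilityMeasure P]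
    (hτ : Measurable τ) {B : Set (Time T × Ω)} (hB : MeasurableSet[𝓕.predictable] B) :
    IsInnerApproximable P 𝓕 τ B := by
  suffices h : IsInnerApproximable P 𝓕 τ B ∧ IsInnerApproximable P 𝓕 τ Bᶜ from h.1
  refine MeasurableSpace.generateFrom_induction _
    (fun B _ => IsInnerApproximable P 𝓕 τ B ∧ IsInnerApproximable P 𝓕 τ Bᶜ) ?_ ?_ ?_ ?_ B hB
  · rintro _ (⟨A, hA, rfl⟩ | ⟨i, A, hA, rfl⟩) -
    · refine ⟨isInnerApproximable_singleton_bot_prod hA, ?_⟩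
      have : (({⊥} : Set (Time T)) ×ˢ A)ᶜ = ({⊥} ×ˢ Aᶜ) ∪ (Ioi ⊥ ×ˢ univ) := by
        ext ⟨s, ω⟩
        simp only [mem_compl_iff, mem_prod, mem_singleton_iff, mem_union, mem_Ioi, mem_univ,
          and_true, bot_lt_iff_ne_bot]
        tauto
      rw [this]
      exact (isInnerApproximable_singleton_bot_prod hA.compl).union hτ
        (isInnerApproximable_Ioi_prod hτ MeasurableSet.univ)
    · refine ⟨isInnerApproximable_Ioi_prod hτ hA, ?_⟩
      have : (Ioi i ×ˢ A)ᶜ = {x : Time T × Ω | x.1 ∈ Iic i} ∪ (Ioi i ×ˢ Aᶜ) := by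
        ext ⟨s, ω⟩
        simp only [mem_compl_iff, mem_prod, mem_union, mem_Ioi, mem_ofPred_eq, mem_Iic, ← not_lt]
        tauto
      rw [this]
      exact (isForeseeable_const (𝓕 := 𝓕) isClosed_Iic).isInnerApproximable.union hτ
        (isInnerApproximable_Ioi_prod hτ hA.compl)
  · have hempty := (isForeseeable_const (𝓕 := 𝓕) (T := T) isClosed_empty).isInnerApproximable
      (P := P) (τ := τ)
    have huniv := (isForeseeable_const (𝓕 := 𝓕) (T := T) isClosed_univ).isInnerApproximable
      (P := P) (τ := τ)
    refine ⟨by simpa using hempty, by simpa using huniv⟩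
  · intro B _ h
    exact ⟨h.2, by rw [compl_compl]; exact h.1⟩
  · intro B _ h
    refine ⟨IsInnerApproximable.iUnion hτ fun n => (h n).1, ?_⟩
    rw [compl_iUnion]
    exact IsInnerApproximable.iInter fun n => (h n).2

end InnerApproximation

/-! ### Predictable times inside predictable sets -/

section Section

variable {Ω : Type*} [mΩ : MeasurableSpace Ω] {T : ℝ} [Fact (0 ≤ T)] {P : Measure Ω}
  {𝓕 : Filtration (Time T) mΩ}

/-- A limit of stopping times that are smaller than it, strictly so where it is positive, is a
predictable time. -/
theorem isPredictableTime_of_tendsto {τ : Ω → Time T} {σ : ℕ → Ω → Time T}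
    (hσ : ∀ n, IsStopping 𝓕 (σ n)) (hle : ∀ n ω, σ n ω ≤ τ ω)
    (hlt : ∀ ω, ⊥ < τ ω → ∀ n, σ n ω < τ ω)
    (hlim : ∀ ω, Tendsto (fun n => σ n ω) atTop (𝓝 (τ ω))) : IsPredictableTime P 𝓕 τ := by
  refine ⟨isStopping_iff.2 fun t => ?_, fun n => partialSups σ n,
    fun n => IsStopping.partialSups hσ n, Eventually.of_forall fun ω => ⟨?_, ?_, ?_⟩⟩
  · have hset : {ω | τ ω ≤ t} = ⋂ n, {ω | σ n ω ≤ t} := by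
      ext ω
      simp only [mem_ofPred_eq, mem_iInter]
      exact ⟨fun h n => (hle n ω).trans h, fun h => le_of_tendsto' (hlim ω) h⟩
    rw [hset]
    exact MeasurableSet.iInter fun n => isStopping_iff.1 (hσ n) t
  · exact fun m n hmn => (partialSups σ).mono hmn ω
  · intro h0 n
    exact partialSups_iff_forall (f := σ) (fun s => s ω < τ ω) (by simp) |>.2
      fun k _ => hlt ω h0 k
  · refine tendsto_of_tendsto_of_tendsto_of_le_of_le (hlim ω) tendsto_const_nhds
      (fun n => le_partialSups σ n ω) fun n => ?_
    exact partialSups_le σ n τ (fun k _ => hle k) ω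

/-- The debut of a decreasing intersection of foreseeable sets is predictable. If `D n` is foreseen
by `δ n`, its debut minus `δ n` is a stopping time; by compactness the debuts of the `D n` converge
to the debut of the intersection. -/
theorem exists_isPredictableTime_isLeast {D : ℕ → Ω → Set (Time T)}
    (hD : ∀ n, IsForeseeable 𝓕 (D n)) (hanti : ∀ ω, Antitone (fun n => D n ω))
    (htop : ∀ n ω, ⊤ ∈ D n ω) :
    ∃ τ : Ω → Time T, IsPredictableTime P 𝓕 τ ∧ ∀ ω, IsLeast (⋂ n, D n ω) (τ ω) := by
  have hleast : ∀ n ω, ∃ e, IsLeast (D n ω) e := fun n ω =>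
    ((hD n).isClosed ω).isCompact.exists_isLeast ⟨⊤, htop n ω⟩
  choose e he using hleast
  have hτ : ∀ ω, ∃ e, IsLeast (⋂ n, D n ω) e := fun ω =>
    (isClosed_iInter fun n => (hD n).isClosed ω).isCompact.exists_isLeast
      ⟨⊤, mem_iInter.2 fun n => htop n ω⟩
  choose τ hτ using hτ
  have hemono : ∀ ω, Monotone (fun n => e n ω) := fun ω m n hmn =>
    (he m ω).2 (hanti ω hmn (he n ω).1)
  have heτ : ∀ n ω, e n ω ≤ τ ω := fun n ω => (he n ω).2 (mem_iInter.1 (hτ ω).1 n)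
  have helim : ∀ ω, Tendsto (fun n => e n ω) atTop (𝓝 (τ ω)) := by
    intro ω
    have h1 := tendsto_atTop_iSup (hemono ω)
    have h2 : ⨆ n, e n ω ∈ ⋂ n, D n ω := by
      refine mem_iInter.2 fun m => ((hD m).isClosed ω).mem_of_tendsto h1 ?_
      filter_upwards [eventually_ge_atTop m] with n hn
      exact hanti ω hn (he n ω).1
    have h3 : ⨆ n, e n ω = τ ω := le_antisymm (iSup_le fun n => heτ n ω) ((hτ ω).2 h2)
    rwa [h3] at h1
  choose δ hδ hDδ using fun n => (hD n).exists_delta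
  set η : ℕ → ℝ := fun n => min (δ n) (1 / (n + 1)) with hη
  have hηpos : ∀ n, 0 < η n := fun n => lt_min (hδ n) (by positivity)
  have hηlim : Tendsto η atTop (𝓝 0) :=
    squeeze_zero (fun n => (hηpos n).le) (fun n => min_le_right _ _)
      tendsto_one_div_add_atTop_nhds_zero_nat
  have hmem : ∀ n ω, max 0 ((e n ω : ℝ) - η n) ∈ Icc 0 T := fun n ω =>
    ⟨le_max_left _ _, max_le ((e n ω).2.1.trans (e n ω).2.2)
      ((sub_le_self _ (hηpos n).le).trans (e n ω).2.2)⟩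
  set σ : ℕ → Ω → Time T := fun n ω => ⟨max 0 ((e n ω : ℝ) - η n), hmem n ω⟩ with hσ
  have hσe : ∀ n ω, σ n ω ≤ e n ω := fun n ω =>
    max_le (e n ω).2.1 (sub_le_self _ (hηpos n).le)
  refine ⟨τ, isPredictableTime_of_tendsto (σ := σ) (fun n => isStopping_iff.2 fun t => ?_)
    (fun n ω => (hσe n ω).trans (heτ n ω)) (fun ω h0 n => ?_) (fun ω => ?_), hτ⟩
  · have hset : {ω | σ n ω ≤ t} = {ω | (D n ω ∩ {s | (s : ℝ) ≤ t + η n}).Nonempty} := by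
      ext ω
      have h1 : σ n ω ≤ t ↔ (e n ω : ℝ) ≤ t + η n := by
        rw [← Subtype.coe_le_coe, hσ]
        simp only [max_le_iff, t.2.1, true_and, sub_le_iff_le_add]
      rw [mem_ofPred_eq, h1]
      exact ⟨fun h => ⟨e n ω, (he n ω).1, h⟩,
        fun ⟨s, hs, hst⟩ => le_trans (Subtype.coe_le_coe.2 ((he n ω).2 hs)) hst⟩
    rw [hset]
    exact measurableSet_foreseen_mono (min_le_left _ _) (hDδ n) t _
  · have h1 : (e n ω : ℝ) ≤ τ ω := heτ n ω
    have h2 : (0 : ℝ) < τ ω := h0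
    exact max_lt h2 (by linarith [hηpos n])
  · rw [tendsto_subtype_rng]
    have h1 : Tendsto (fun n => (e n ω : ℝ)) atTop (𝓝 (τ ω)) :=
      (continuous_subtype_val.tendsto _).comp (helim ω)
    have h2 := (tendsto_const_nhds (x := (0 : ℝ))).max (h1.sub hηlim)
    rw [sub_zero, max_eq_right (τ ω).2.1] at h2
    exact h2

/-- A section theorem for predictable graphs: a random time whose graph contains the predictable
set `B` coincides on `B` with one of countably many predictable times. -/
theorem exists_isPredictableTime_of_subset_graph [IsProbabilityMeasure P] {τ : Ω → Time T}
    (hτ : Measurable τ) {B : Set (Time T × Ω)} (hB : MeasurableSet[𝓕.predictable] B)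
    (hBτ : ∀ s ω, (s, ω) ∈ B → s = τ ω) :
    ∃ σ : ℕ → Ω → Time T, (∀ n, IsPredictableTime P 𝓕 (σ n)) ∧
      ∀ᵐ ω ∂P, (τ ω, ω) ∈ B → ∃ n, σ n ω = τ ω := by
  have happ := isInnerApproximable_of_predictable (P := P) (𝓕 := 𝓕) hτ hB
  have hpos : ∀ n : ℕ, (0 : ENNReal) < (n + 1 : ENNReal)⁻¹ := fun n =>
    ENNReal.inv_pos.2 (by finiteness)
  choose C hC hCB hCP using fun n : ℕ => happ _ (hpos n)
  choose D hD hDC using hC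
  -- `⊤` is added to the random sets, so that a debut always exists
  have hdebut := fun n => exists_isPredictableTime_isLeast (P := P)
    (D := fun m ω => D n m ω ∪ {⊤}) (fun m => (hD n m).union (isForeseeable_const
      isClosed_singleton)) (fun ω k m hkm => union_subset_union_left _ ((hDC n ω).1 hkm))
    (fun m ω => Or.inr rfl)
  choose σ hσ hleast using hdebut
  refine ⟨σ, hσ, ?_⟩
  have hCσ : ∀ n ω, τ ω ∈ C n ω → σ n ω = τ ω := by
    intro n ω h
    have hl := hleast n ω
    rw [← iInter_union, ← (hDC n ω).2] at hl
    have hle := hl.2 (Or.inl h)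
    rcases hl.1 with h1 | h1
    · exact hBτ _ _ (hCB n ω _ h1)
    · rw [mem_singleton_iff] at h1
      rw [h1] at hle ⊢
      exact (top_le_iff.1 hle).symm
  have hzero : P {ω | (τ ω, ω) ∈ B ∧ ∀ n, τ ω ∉ C n ω} = 0 := by
    have hlim : Tendsto (fun n : ℕ => ((n + 1 : ENNReal))⁻¹) atTop (𝓝 0) :=
      mod_cast (tendsto_add_atTop_iff_nat 1).2 ENNReal.tendsto_inv_nat_nhds_zero
    refine le_antisymm (ge_of_tendsto' hlim fun n => ?_) zero_le
    · refine (measure_mono ?_).trans (hCP n)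
      exact fun ω hω => ⟨hω.1, hω.2 n⟩
  rw [ae_iff]
  refine measure_mono_null (fun ω hω => ?_) hzero
  simp only [mem_ofPred_eq, Classical.not_imp, not_exists] at hω
  exact ⟨hω.1, fun n hn => hω.2 n (hCσ n ω hn)⟩

end Section

/-! ### Jump times of predictable increasing processes -/

section JumpTimes

variable {Ω : Type*} [mΩ : MeasurableSpace Ω] {T : ℝ} [Fact (0 ≤ T)] {P : Measure Ω}
  {𝓕 : Filtration (Time T) mΩ}

/-- The time at which a predictable increasing process first reaches the level `a`, if it is
strictly below `a` before, is almost surely one of countably many predictable times, since the graph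
of this time is a predictable set. -/
theorem exists_isPredictableTime_level [IsProbabilityMeasure P] (h_usual : UsualConditions P 𝓕)
    {K : Time T → Ω → ℝ} (hK : IsPredictableIncreasing P 𝓕 K) (a : ℝ) :
    ∃ σ : ℕ → Ω → Time T, (∀ n, IsPredictableTime P 𝓕 (σ n)) ∧
      ∀ᵐ ω ∂P, ∀ t, a ≤ K t ω → (∀ s < t, K s ω < a) → ∃ n, σ n ω = t := by
  obtain ⟨Q, hQc, hQd⟩ := TopologicalSpace.exists_countable_dense (Time T)
  set G : Set Ω := {ω | Monotone (fun t => K t ω)} with hG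
  have hGnull : P Gᶜ = 0 := ae_iff.1 hK.monotone
  have hGm : MeasurableSet[𝓕 ⊥] G := by
    have := (h_usual.complete _ hGnull).compl
    rwa [compl_compl] at this
  have hKm : ∀ t, StronglyMeasurable[𝓕 t] (K t) :=
    hK.predictable.isStronglyProgressive.stronglyAdapted
  have hle : ∀ t, MeasurableSet[𝓕 t] {ω | a ≤ K t ω} := fun t =>
    (hKm t).measurable measurableSet_Ici
  set S : Ω → Set (Time T) := fun ω => {t | ω ∈ G ∧ a ≤ K t ω} with hS
  set τ : Ω → Time T := fun ω => sInf (S ω) with hτ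
  have hτm : Measurable τ := by
    refine measurable_of_Iio fun t => ?_
    have hset : τ ⁻¹' Iio t = ⋃ q ∈ Q ∩ Iio t, G ∩ {ω | a ≤ K q ω} := by
      ext ω
      simp only [mem_preimage, mem_Iio, mem_iUnion, exists_prop, hτ, sInf_lt_iff]
      refine ⟨?_, ?_⟩
      · rintro ⟨s, ⟨hω, hs⟩, hst⟩
        obtain ⟨q, hq, hsq, hqt⟩ := hQd.exists_between hst
        exact ⟨q, ⟨hq, hqt⟩, hω, hs.trans (hω hsq.le)⟩
      · rintro ⟨q, ⟨-, hqt⟩, hω, hq⟩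
        exact ⟨q, ⟨hω, hq⟩, hqt⟩
    rw [hset]
    exact MeasurableSet.biUnion (hQc.mono inter_subset_left) fun q _ =>
      (𝓕.le _ _ hGm).inter (𝓕.le _ _ (hle q))
  -- the part of the graph of `τ` where the level is attained, written with countably many times
  set B : Set (Time T × Ω) := ({⊥} ×ˢ G ∪ Ioi ⊥ ×ˢ G) ∩ {x | a ≤ K x.1 x.2} ∩
    ⋂ q ∈ Q, (Ioi q ×ˢ {ω | a ≤ K q ω})ᶜ with hB
  have hBm : MeasurableSet[𝓕.predictable] B := by
    refine (((measurableSet_predictable_singleton_bot_prod hGm).union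
      (measurableSet_predictable_Ioi_prod hGm)).inter ?_).inter ?_
    · exact hK.predictable.measurable measurableSet_Ici
    · exact MeasurableSet.biInter hQc fun q _ =>
        (measurableSet_predictable_Ioi_prod (hle q)).compl
  have hBmem : ∀ s ω, (s, ω) ∈ B ↔ ω ∈ G ∧ a ≤ K s ω ∧ ∀ q ∈ Q, q < s → K q ω < a := by
    intro s ω
    simp only [hB, mem_inter_iff, mem_union, mem_prod, mem_singleton_iff, mem_Ioi, mem_iInter,
      mem_compl_iff, mem_ofPred_eq, not_and, not_le, ← or_and_right, and_assoc]
    have : s = ⊥ ∨ ⊥ < s := eq_bot_or_bot_lt s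
    tauto
  have hBτ : ∀ s ω, (s, ω) ∈ B → s = τ ω := by
    intro s ω hs
    obtain ⟨hω, hsa, hq⟩ := (hBmem s ω).1 hs
    have hleast : IsLeast (S ω) s := by
      refine ⟨⟨hω, hsa⟩, fun r hr => not_lt.1 fun hrs => ?_⟩
      obtain ⟨q, hqQ, hrq, hqs⟩ := hQd.exists_between hrs
      exact absurd (hr.2.trans (hω hrq.le)) (not_le.2 (hq q hqQ hqs))
    exact hleast.isGLB.sInf_eq.symm
  obtain ⟨σ, hσ, hae⟩ := exists_isPredictableTime_of_subset_graph (P := P) hτm hBm hBτ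
  refine ⟨σ, hσ, ?_⟩
  filter_upwards [hae, hK.monotone] with ω hω hmono t ht hlt
  have htB : (t, ω) ∈ B := (hBmem t ω).2 ⟨hmono, ht, fun q _ hq => hlt q hq⟩
  have htτ := hBτ t ω htB
  rw [htτ] at htB ⊢
  exact hω htB

/-- The jump times of a predictable increasing process are almost surely exhausted by countably
many predictable times: every jump passes over a rational level. -/
theorem exists_isPredictableTime_exhausting_jumps [IsProbabilityMeasure P]
    (h_usual : UsualConditions P 𝓕) {K : Time T → Ω → ℝ} (hK : IsPredictableIncreasing P 𝓕 K) :
    ∃ σ : ℚ → ℕ → Ω → Time T, (∀ a n, IsPredictableTime P 𝓕 (σ a n)) ∧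
      ∀ᵐ ω ∂P, ∀ t, jump (fun s => K s ω) t ≠ 0 → ∃ a n, σ a n ω = t := by
  choose σ hσ hae using fun a : ℚ => exists_isPredictableTime_level (P := P) h_usual hK a
  refine ⟨σ, hσ, ?_⟩
  filter_upwards [ae_all_iff.2 hae, hK.monotone] with ω hω hmono t ht
  have hpos : 0 < jump (fun s => K s ω) t := lt_of_le_of_ne (jump_nonneg hmono t) ht.symm
  obtain ⟨a, ha, hat⟩ := exists_rat_btwn (sub_pos.1 hpos)
  exact ⟨a, hω a t hat.le fun s hs => (hmono.le_leftLim hs).trans_lt ha⟩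

end JumpTimes

end ORBSDE

/-! ### Continuity of the reflection processes -/

theorem mainTheorem4
    {Ω : Type*} [mΩ : MeasurableSpace Ω] (P : Measure Ω) [IsProbabilityMeasure P]
    (T : ℝ) [Fact (0 ≤ T)] (𝓕 : Filtration (ORBSDE.Time T) mΩ)
    (h_usual : ORBSDE.UsualConditions P 𝓕)
    (h_qlc : ORBSDE.QuasiLeftContinuous P 𝓕)
    (d : ℕ) (hd : 2 ≤ d)
    -- the data: terminal condition, generator, finite variation driver, upper barrier
    (ξ : Fin d → Ω → ℝ) (hξ : ∀ j, Measurable[𝓕 ⊤] (ξ j))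
    (f : Fin d → ORBSDE.Time T → Ω → (Fin d → ℝ) → ℝ)
    (hf_meas : ∀ j, Measurable
      (fun p : ORBSDE.Time T × Ω × (Fin d → ℝ) => f j p.1 p.2.1 p.2.2))
    (hf_prog : ∀ j y, IsStronglyProgressive 𝓕 (fun t ω => f j t ω y))
    (V : Fin d → ORBSDE.Time T → Ω → ℝ)
    (hV : ∀ j, ORBSDE.IsFiniteVariation P 𝓕 (V j))
    (hV_jumps : ∀ j, ORBSDE.NoPredictableJumps P 𝓕 (V j))
    (U : Fin d → ORBSDE.Time T → Ω → ℝ)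
    (hU : ∀ j, ORBSDE.IsCadlagAdapted P 𝓕 (U j))
    -- the functions `h_{j,k}` and the reflection function `H^j = max_{k ≠ j} h_{j,k}`
    (h : Fin d → Fin d → ORBSDE.Time T → Ω → ℝ → ℝ)
    (h_cont : ∀ᵐ ω ∂P, ∀ j k, j ≠ k →
      Continuous (fun p : ORBSDE.Time T × ℝ => h j k p.1 ω p.2))
    (h_le : ∀ᵐ ω ∂P, ∀ j k, j ≠ k → ∀ t c, h j k t ω c ≤ c)
    (H_mono : ∀ᵐ ω ∂P, ∀ j t (y y' : Fin d → ℝ), y ≤ y' →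
      ORBSDE.obliqueMax h j t ω y ≤ ORBSDE.obliqueMax h j t ω y')
    (h_noCycle : ∀ᵐ ω ∂P, ORBSDE.NoCycle (fun j k t c => h j k t ω c))
    -- the solution
    (Y M K A : Fin d → ORBSDE.Time T → Ω → ℝ)
    (h_sol : ORBSDE.IsSolution P 𝓕 ξ f V (ORBSDE.obliqueMax h) U Y M K A)
    (hKA : ∀ᵐ ω ∂P, ∀ j t,
      ORBSDE.jump (fun s => K j s ω) t = 0 ∨ ORBSDE.jump (fun s => A j s ω) t = 0) :
    ∀ᵐ ω ∂P, ∀ j, Continuous (fun t => K j t ω) := by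
  choose σ hσ hexh using fun j =>
    ORBSDE.exists_isPredictableTime_exhausting_jumps (P := P) h_usual
      (h_sol.K_predictableIncreasing j)
  have hVσ : ∀ᵐ ω ∂P, ∀ j a n i, ORBSDE.jump (fun t => V i t ω) (σ j a n ω) = 0 := by
    simp only [ae_all_iff]
    exact fun j a n i => hV_jumps i _ (hσ j a n)
  have hMσ : ∀ᵐ ω ∂P, ∀ j a n i, ORBSDE.jump (fun t => M i t ω) (σ j a n ω) = 0 := by
    simp only [ae_all_iff]
    exact fun j a n i => ORBSDE.jump_localMartingale_eq_zero h_usual h_qlc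
      (h_sol.M_localMartingale i) (hσ j a n)
  have hYc := ae_all_iff.2 fun j => (h_sol.Y_cadlagAdapted j).cadlag
  have hMc := ae_all_iff.2 fun j => (h_sol.M_localMartingale j).cadlagAdapted.cadlag
  have hKc := ae_all_iff.2 fun j => (h_sol.K_predictableIncreasing j).cadlag
  have hAc := ae_all_iff.2 fun j => (h_sol.A_predictableIncreasing j).cadlag
  have hKm := ae_all_iff.2 fun j => (h_sol.K_predictableIncreasing j).monotone
  have hAm := ae_all_iff.2 fun j => (h_sol.A_predictableIncreasing j).monotone
  filter_upwards [ae_all_iff.2 hexh, hVσ, hMσ, hYc, hMc, hKc, hAc, hKm, hAm, h_cont, H_mono,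
    h_noCycle, hKA, h_sol.barriers, h_sol.minimality_K, h_sol.generator_integrable,
    h_sol.equation] with ω hex hVj hMj hY hM hK hA hKmono hAmono hcont hHmono hcyc hKAj hbar hmin
    hint heq j
  refine (hK j).continuous_of_jump_eq_zero fun t => ?_
  by_contra hne
  obtain ⟨a, n, hσt⟩ := hex j t hne
  refine hne (ORBSDE.jump_eq_zero_of_equation hd hcont hHmono hcyc
    (x := fun i => ξ i ω) (g := fun i r => f i r ω (fun k => Y k r ω))
    (V := fun i s => V i s ω) (Y := fun i s => Y i s ω) (M := fun i s => M i s ω)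
    (K := fun i s => K i s ω) (A := fun i s => A i s ω) hY hM hK hA hKmono hAmono
    (fun i s => (hbar i s).1) hmin hint heq hKAj ?_ ?_ j)
  · intro i
    have := hMj j a n i
    rwa [hσt] at this
  · intro i
    have := hVj j a n i
    rwa [hσt] at this
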